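/- **Theorem 4.1.** Let $L>0$, $x_0<0$, $\beta\in(0,1)$ and $T>0$ be such that $\beta T>\sup_{x\in(0,L)}|x-x_0|$ (so that also $T>\sup_{x\in(0,L)}|x-x_0|$). Set $\varphi(t,x)=|x-x_0|^2-\beta t^2$ and $$\mathcal O=\{(t,x)\in(0,T)\times(0,L):\ \beta t>|x-x_0|\}.$$ For $N\in\mathbb N$ let $h=L/(N+1)$ and $x_j=jh$ for $0\le j\le N+1$. For a mesh function $f_h=(f_j)_{0\le j\le N+1}$ write $$\int_{(0,L)_h}f_h=h\sum_{j=1}^N f_j,\quad (\partial_h^+f_h)_j=(\partial_h^-f_h)_{j+1}=\frac{f_{j+1}-f_j}{h},\quad (\Delta_hf_h)_j=\frac{f_{j+1}-2f_j+f_{j-1}}{h^2},$$ and let $\mathcal L_{s,0,h}y_h=e^{s\varphi}(\partial_t^2-\Delta_h)(e^{-s\varphi}y_h)$ on $(-T,T)\times\{x_1,\dots,x_N\}$. Then there exist $s_0>0$, $N_0>0$, $\varepsilon_0>0$ and $M>0$, depending only on $L,T,\beta,x_0$, such that for all $N\ge N_0$, all $s\in[s_0,\varepsilon_0/h]$ and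 all real-valued $y_h=(y_j)_{0\le j\le N+1}$ on $(-T,T)$ with $y_0=y_{N+1}=0$ and $y_j\in H^2(-T,T)$ for $1\le j\le N$, $$\begin{aligned} & s\int_{-T}^T\int_{(0,L)_h}\bigl(|\partial_ty_h|^2+|\partial_h^+y_h|^2+s^2|y_h|^2\bigr)\,dt\\ &\le M\int_{-T}^T\int_{(0,L)_h}|\mathcal L_{s,0,h}y_h|^2\,dt+Ms\int_{-T}^T|(\partial_h^-y_h)_{N+1}(t)|^2\,dt\\ &\quad+Ms^3\int_{-T}^T\int_{(0,L)_h}\mathbf 1_{(|t|,x_j)\in\mathcal O}|y_h|^2\,dt+Msh^2\int_{-T}^T\int_{(0,L)_h}|\partial_t\partial_h^+y_h|^2\,dt. \end{aligned}$$ Furthermore, if $y_j(0)=0$ for all $1\le j\le N$, the same inequality holds with the term $s^{1/2}\int_{(0,L)_h}|\partial_ty_h(0)|^2$ added to the left-hand side. -/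

import Mathlib

open MeasureTheory

namespace SemiDiscreteWave

/-! ### Sobolev regularity in time -/

/-- `g` is the weak derivative of `f` on `(a, b)`, tested against `C_c^∞(a, b)`. -/
def HasWeakDerivOn (a b : ℝ) (f g : ℝ → ℝ) : Prop :=
  ∀ ψ : ℝ → ℝ, ContDiff ℝ (⊤ : ℕ∞) ψ → HasCompactSupport ψ → tsupport ψ ⊆ Set.Ioo a b →
    ∫ t in Set.Ioo a b, f t * deriv ψ t = -∫ t in Set.Ioo a b, g t * ψ t

/-- `f` is the continuous representative of an element of the Sobolev space `H²(a, b)`: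
`f` and its weak derivatives of order one and two are in `L²(a, b)`. Such an `f` is `C¹` on
`(a, b)`, its derivative is absolutely continuous, and the classical derivatives `deriv f` and
`deriv (deriv f)` (the latter existing almost everywhere) are the weak ones. -/
structure MemH2 (a b : ℝ) (f : ℝ → ℝ) : Prop where
  continuousOn : ContinuousOn f (Set.Ioo a b)
  memLp : MemLp f 2 (volume.restrict (Set.Ioo a b))
  exists_weakDeriv : ∃ g₁ g₂ : ℝ → ℝ,
    MemLp g₁ 2 (volume.restrict (Set.Ioo a b)) ∧ MemLp g₂ 2 (volume.restrict (Set.Ioo a b)) ∧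
    HasWeakDerivOn a b f g₁ ∧ HasWeakDerivOn a b g₁ g₂

/-! ### The continuous geometry on `Ω = (0, L)` -/

/-- `sup_{x ∈ (0, L)} |x - x₀|`. -/
noncomputable def supDist (L x₀ : ℝ) : ℝ := sSup ((fun x : ℝ => |x - x₀|) '' Set.Ioo 0 L)

/-- The Carleman weight `φ(t, x) = |x - x₀|² - β t²`. -/
def weight (β x₀ t x : ℝ) : ℝ := |x - x₀| ^ 2 - β * t ^ 2

/-- The set `𝒪 = {(t, x) ∈ (0, T) × (0, L) : β t > |x - x₀|}`. -/
def obsSet (β x₀ L T : ℝ) : Set (ℝ × ℝ) :=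
  {p | p.1 ∈ Set.Ioo 0 T ∧ p.2 ∈ Set.Ioo 0 L ∧ |p.2 - x₀| < β * p.1}

/-! ### Mesh functions and difference operators

A function on the mesh `x_j = j h`, `0 ≤ j ≤ N + 1`, is a sequence `v : ℕ → ℝ` of which only the
entries `v 0, …, v (N + 1)` are ever used. -/

/-- The mesh size `h = L / (N + 1)`. -/
noncomputable def meshSize (L : ℝ) (N : ℕ) : ℝ := L / (N + 1)

/-- `∫_{(0, L)_h} f_h = h ∑_{j = 1}^N f_j`. -/
noncomputable def meshIntegral (L : ℝ) (N : ℕ) (f : ℕ → ℝ) : ℝ :=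
  meshSize L N * ∑ j ∈ Finset.Icc 1 N, f j

/-- `(∂_h^+ v)_j = (v_{j+1} - v_j) / h`. -/
noncomputable def diffPlus (h : ℝ) (v : ℕ → ℝ) (j : ℕ) : ℝ := (v (j + 1) - v j) / h

/-- `(∂_h^- v)_j = (v_j - v_{j-1}) / h`, for `j ≥ 1`. -/
noncomputable def diffMinus (h : ℝ) (v : ℕ → ℝ) (j : ℕ) : ℝ := (v j - v (j - 1)) / h

/-- `(Δ_h v)_j = (v_{j+1} - 2 v_j + v_{j-1}) / h²`, for `j ≥ 1`. -/
noncomputable def discreteLaplacian (h : ℝ) (v : ℕ → ℝ) (j : ℕ) : ℝ :=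
  (v (j + 1) - 2 * v j + v (j - 1)) / h ^ 2

/-- The semi-discrete wave operator `((∂_t² - Δ_h + q_h) z_h)_j (t)`, for `j ≥ 1`. -/
noncomputable def waveOp (h : ℝ) (q : ℕ → ℝ) (z : ℕ → ℝ → ℝ) (j : ℕ) (t : ℝ) : ℝ :=
  deriv (deriv (z j)) t - discreteLaplacian h (fun i => z i t) j + q j * z j t

/-- The conjugated operator `ℒ_{s,q_h,h} y_h = e^{sφ} (∂_t² - Δ_h + q_h) (e^{-sφ} y_h)`. -/
noncomputable def conjWaveOp (β x₀ s h : ℝ) (q : ℕ → ℝ) (y : ℕ → ℝ → ℝ) (j : ℕ) (t : ℝ) : ℝ :=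
  Real.exp (s * weight β x₀ t (j * h)) *
    waveOp h q (fun i τ => Real.exp (-s * weight β x₀ τ (i * h)) * y i τ) j t

/-! ### The two sides of the estimate -/

/-- `s ∫_{-T}^T ∫_{(0,L)_h} (|∂_t y_h|² + |∂_h^+ y_h|² + s² |y_h|²) dt`. -/
noncomputable def carlemanLHS (L T s : ℝ) (N : ℕ) (y : ℕ → ℝ → ℝ) : ℝ :=
  s * ∫ t in (-T)..T, meshIntegral L N fun j =>
    |deriv (y j) t| ^ 2 + |diffPlus (meshSize L N) (fun i => y i t) j| ^ 2 + s ^ 2 * |y j t| ^ 2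

open Classical in
/-- The right-hand side: the source term, the flux at `x = L`, the term localized on `𝒪`, and the
high-frequency term, each with the constant `M`. -/
noncomputable def carlemanRHS (β x₀ L T M s : ℝ) (N : ℕ) (y : ℕ → ℝ → ℝ) : ℝ :=
  M * (∫ t in (-T)..T, meshIntegral L N fun j =>
      |conjWaveOp β x₀ s (meshSize L N) (fun _ => 0) y j t| ^ 2)
  + M * s * (∫ t in (-T)..T, |diffMinus (meshSize L N) (fun i => y i t) (N + 1)| ^ 2)
  + M * s ^ 3 * (∫ t in (-T)..T, meshIntegral L N fun j =>
      if (|t|, (j : ℝ) * meshSize L N) ∈ obsSet β x₀ L T then |y j t| ^ 2 else 0)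
  + M * s * meshSize L N ^ 2 * (∫ t in (-T)..T, meshIntegral L N fun j =>
      |deriv (fun τ => diffPlus (meshSize L N) (fun i => y i τ) j) t| ^ 2)

end SemiDiscreteWave

open SemiDiscreteWave

/-!
The proof is a multiplier argument without any cut-off in time. The weight separates,
`φ = |x - x₀|² - β t²`, and its increments across the mesh edges are affine in the position of the
edge. Hence the conjugated discrete Laplacian has an exact decomposition into a symmetric part
(`symOp`, weights `cosh`) and a skew part (`skewOp`, weights `sinh`), whose commutator is computed
in closed form by the addition theorems for hyperbolic functions (`neg_sum_symOp_mul_skewOp`).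

With `τ = 2 β s t`, the conjugated wave operator is `P + Q` where `P y = y'' + τ² y - symOp y`
(`mainPart`) and `Q` is skew up to boundary terms. The product of `P y` with the multiplier
`2 τ y' + skewOp y - (1 + β) s y - (1 + β) / 2 * s h² symOp y`, which differs from `Q y` by
`O(s) y`, is the time derivative of `boundaryForm` plus `bulkForm` (`sum_mainPart_mul_multiplier`).

* The multiple of `y` is chosen so that `|y'|²` and `|∂_x y|²` both get a positive coefficient, of
  order `(1 - β) s`; the multiple of `h² symOp y` makes up for the loss of high frequencies in the
  centered differences of the commutator, at the price of the term `s h² |∂_t ∂_h^+ y|²`. The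
  coefficient of `s³ |y|²` is positive where `|x - x₀| ≥ β |t|`, and the term on `𝒪` covers the
  rest (`FineMesh.le_bulkForm`). The first mesh edge, absent from the high-frequency term, is
  handled by `first_node_sq_le`.
* At `t = ± T` one has `β T > |x - x₀|`, so that the weight is time-like there and the boundary
  terms have a favorable sign (`FineMesh.boundaryForm_nonneg`). No condition at `t = ± T` is needed.

This gives the estimate with `∫ |P y|²` kept on the left. If `y` vanishes at `t = 0`, the
velocity at `t = 0` is controlled by integrating the derivative of `(1 + t / T)` times the energy of
`P` over `(-T, 0)` (`FineMesh.energy_growth_le`).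

Elements of `H²(-T, T)` are `C¹` with absolutely continuous derivative (`MemH2.exists_regular`, by
the du Bois-Reymond lemma), which justifies the integrations in time.
-/

namespace SemiDiscreteWave

/-! ### Sobolev functions on an interval -/

theorem hasWeakDerivOn_primitive {a b : ℝ} (hab : a ≤ b) {g : ℝ → ℝ}
    (hg : IntervalIntegrable g volume a b) (c : ℝ) :
    HasWeakDerivOn a b (fun t => c + ∫ x in a..t, g x) g := by
  intro ψ hψ _ hsupp
  have hF : AbsolutelyContinuousOnInterval (fun t => c + ∫ x in a..t, g x) a b := by
    have h1 : AbsolutelyContinuousOnInterval (fun _ : ℝ => c) a b :=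
      (contDiff_const.contDiffOn (s := Set.uIcc a b)).absolutelyContinuousOnInterval
    exact h1.add (hg.absolutelyContinuousOnInterval_intervalIntegral (c := a) (by simp))
  have hψ' : AbsolutelyContinuousOnInterval ψ a b :=
    ((hψ.of_le (by exact_mod_cast le_top)).contDiffOn).absolutelyContinuousOnInterval
  have hψ0 : ∀ x, x ∉ Set.Ioo a b → ψ x = 0 := fun x hx =>
    image_eq_zero_of_notMem_tsupport fun h => hx (hsupp h)
  have key := hF.integral_mul_deriv_eq_deriv_mul hψ'
  rw [hψ0 a (by simp), hψ0 b (by simp), mul_zero, mul_zero, sub_zero, zero_sub,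
    intervalIntegral.integral_of_le hab, integral_Ioc_eq_integral_Ioo] at key
  rw [key]
  congr 1
  rw [← integral_Ioc_eq_integral_Ioo, ← intervalIntegral.integral_of_le hab]
  apply intervalIntegral.integral_congr_ae
  filter_upwards [hg.ae_hasDerivAt_integral] with x hx hx'
  rw [((hx (Set.uIoc_subset_uIcc hx') a (by simp)).const_add c).deriv]

/-- A smooth function with compact support in `(a, b)` and vanishing integral is the derivative of
such a function. -/
theorem exists_primitive_of_integral_eq_zero {a b : ℝ} {ψ : ℝ → ℝ}
    (hψ : ContDiff ℝ (⊤ : ℕ∞) ψ) (hc : HasCompactSupport ψ) (hs : tsupport ψ ⊆ Set.Ioo a b)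
    (h0 : ∫ t, ψ t = 0) :
    ∃ θ : ℝ → ℝ, ContDiff ℝ (⊤ : ℕ∞) θ ∧ HasCompactSupport θ ∧ tsupport θ ⊆ Set.Ioo a b ∧
      deriv θ = ψ := by
  rcases (tsupport ψ).eq_empty_or_nonempty with he | hne
  · have : ψ = 0 := by rwa [tsupport_eq_empty_iff] at he
    refine ⟨0, contDiff_const, HasCompactSupport.zero, by simp, ?_⟩
    rw [this]
    ext x
    simp
  obtain ⟨p, hp, hpl⟩ := hc.isCompact.exists_isLeast hne
  obtain ⟨q, hq, hqg⟩ := hc.isCompact.exists_isGreatest hne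
  have hint : Integrable ψ := hψ.continuous.integrable_of_hasCompactSupport hc
  have hd : ∀ t, HasDerivAt (fun t => ∫ x in p..t, ψ x) (ψ t) t := fun t =>
    intervalIntegral.integral_hasDerivAt_right (hψ.continuous.intervalIntegrable _ _)
      (hψ.continuous.stronglyMeasurableAtFilter _ _) hψ.continuous.continuousAt
  have hderiv : deriv (fun t => ∫ x in p..t, ψ x) = ψ := funext fun t => (hd t).deriv
  have hz : ∀ x, x ∉ Set.Icc p q → ψ x = 0 := fun x hx =>
    image_eq_zero_of_notMem_tsupport fun h => hx ⟨hpl h, hqg h⟩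
  have hsub : Function.support (fun t => ∫ x in p..t, ψ x) ⊆ Set.Icc p q := by
    intro t ht
    by_contra hmem
    apply ht
    rcases lt_or_ge t p with h | h
    · show ∫ x in p..t, ψ x = 0
      rw [intervalIntegral.integral_symm, intervalIntegral.integral_of_le h.le,
        integral_Ioc_eq_integral_Ioo,
        setIntegral_eq_zero_of_forall_eq_zero (fun x hx => hz x fun h' => by
          linarith [hx.2, h'.1]), neg_zero]
    · have hqt : q < t := by
        by_contra h'
        exact hmem ⟨h, not_lt.1 h'⟩
      show ∫ x in p..t, ψ x = 0
      rw [intervalIntegral.integral_of_le h, ← integral_Icc_eq_integral_Ioc,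
        setIntegral_eq_integral_of_forall_compl_eq_zero, h0]
      intro x hx
      exact hz x fun h' => hx ⟨h'.1, h'.2.trans hqt.le⟩
  have hts : tsupport (fun t => ∫ x in p..t, ψ x) ⊆ Set.Icc p q :=
    closure_minimal hsub isClosed_Icc
  refine ⟨fun t => ∫ x in p..t, ψ x, ?_, ?_, ?_, hderiv⟩
  · rw [contDiff_infty_iff_deriv, hderiv]
    exact ⟨fun t => (hd t).differentiableAt, hψ⟩
  · exact HasCompactSupport.of_support_subset_isCompact isCompact_Icc hsub
  · intro x hx
    have := hts hx
    exact ⟨(hs hp).1.trans_le this.1, this.2.trans_lt (hs hq).2⟩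

/-- The du Bois-Reymond lemma: a function with vanishing weak derivative is constant. -/
theorem ae_eq_const_of_hasWeakDerivOn_zero {a b : ℝ} (hab : a < b) {f : ℝ → ℝ}
    (hf : IntegrableOn f (Set.Ioo a b)) (h : HasWeakDerivOn a b f 0) :
    ∃ c : ℝ, ∀ᵐ t, t ∈ Set.Ioo a b → f t = c := by
  let ρ : ContDiffBump ((a + b) / 2) :=
    ⟨(b - a) / 8, (b - a) / 4, by linarith, by linarith⟩
  have hρd : ContDiff ℝ (⊤ : ℕ∞) (ρ.normed volume) := ρ.contDiff_normed
  have hρs : tsupport (ρ.normed volume) ⊆ Set.Ioo a b := by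
    rw [ρ.tsupport_normed_eq, Real.closedBall_eq_Icc]
    intro x hx
    have h1 := hx.1
    have h2 := hx.2
    have : ρ.rOut = (b - a) / 4 := rfl
    rw [this] at h1 h2
    constructor <;> linarith
  have hρc : HasCompactSupport (ρ.normed volume) := ρ.hasCompactSupport_normed
  have hmul : ∀ g : ℝ → ℝ, Continuous g → HasCompactSupport g →
      IntegrableOn (fun t => f t * g t) (Set.Ioo a b) := by
    intro g hg hgc
    obtain ⟨C, hC⟩ := hgc.exists_bound_of_continuous hg
    exact hf.mul_bdd (c := C) hg.aestronglyMeasurable (Filter.Eventually.of_forall hC)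
  set c := ∫ t in Set.Ioo a b, f t * ρ.normed volume t with hcdef
  refine ⟨c, ?_⟩
  have key : ∀ᵐ t, t ∈ Set.Ioo a b → f t - c = 0 := by
    refine IsOpen.ae_eq_zero_of_integral_contDiff_smul_eq_zero isOpen_Ioo ?_ ?_
    · exact (hf.sub (integrableOn_const (by simp))).locallyIntegrableOn
    · intro ψ hψ hψc hψs
      have hψi : Integrable ψ := hψ.continuous.integrable_of_hasCompactSupport hψc
      set m := ∫ t, ψ t with hm
      have hsupp2 : tsupport (fun t => ψ t - m * ρ.normed volume t) ⊆
          tsupport ψ ∪ tsupport (ρ.normed volume) := by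
        refine closure_minimal ?_ ((isClosed_tsupport _).union (isClosed_tsupport _))
        intro t ht
        by_contra hn
        rw [Set.mem_union, not_or] at hn
        apply ht
        simp only [image_eq_zero_of_notMem_tsupport hn.1, image_eq_zero_of_notMem_tsupport hn.2]
        ring
      obtain ⟨θ, hθ, hθc, hθs, hθd⟩ := exists_primitive_of_integral_eq_zero (a := a) (b := b)
        (ψ := fun t => ψ t - m * ρ.normed volume t)
        (hψ.sub (contDiff_const.mul hρd))
        ((hψc.isCompact.union hρc.isCompact).of_isClosed_subset (isClosed_tsupport _) hsupp2)
        (hsupp2.trans (Set.union_subset hψs hρs))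
        (by
          rw [integral_sub hψi (ρ.integrable_normed.const_mul m), integral_const_mul,
            ρ.integral_normed, mul_one, sub_self])
      have h1 := h θ hθ hθc hθs
      simp only [hθd, Pi.zero_apply, zero_mul, integral_zero, neg_zero] at h1
      have e1 : ∫ t in Set.Ioo a b, f t * (ψ t - m * ρ.normed volume t) =
          (∫ t in Set.Ioo a b, f t * ψ t) - m * c := by
        rw [hcdef, ← integral_const_mul, ← integral_sub (hmul ψ hψ.continuous hψc)
          ((hmul _ hρd.continuous hρc).const_mul m)]
        congr 1
        ext t
        ring
      have e2 : ∫ t, ψ t • (f t - c) = ∫ t in Set.Ioo a b, ψ t • (f t - c) := by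
        rw [setIntegral_eq_integral_of_forall_compl_eq_zero]
        intro t ht
        rw [image_eq_zero_of_notMem_tsupport fun h' => ht (hψs h'), zero_smul]
      have e3 : ∫ t in Set.Ioo a b, ψ t = m := by
        rw [hm, setIntegral_eq_integral_of_forall_compl_eq_zero]
        intro t ht
        exact image_eq_zero_of_notMem_tsupport fun h' => ht (hψs h')
      have e4 : ∫ t in Set.Ioo a b, ψ t • (f t - c) =
          (∫ t in Set.Ioo a b, f t * ψ t) - c * ∫ t in Set.Ioo a b, ψ t := by
        rw [← integral_const_mul, ← integral_sub (hmul ψ hψ.continuous hψc)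
          (hψi.integrableOn.const_mul c)]
        congr 1
        ext t
        simp only [smul_eq_mul]
        ring
      rw [e2, e4, e3]
      rw [e1] at h1
      linarith
  filter_upwards [key] with t ht ht'
  linarith [ht ht']

/-- An integrable function with an integrable weak derivative is almost everywhere a primitive
of it. -/
theorem exists_ae_eq_primitive {a b : ℝ} (hab : a < b) {f g : ℝ → ℝ}
    (hf : IntegrableOn f (Set.Ioo a b)) (hg : IntegrableOn g (Set.Ioo a b))
    (h : HasWeakDerivOn a b f g) :
    ∃ c : ℝ, ∀ᵐ t, t ∈ Set.Ioo a b → f t = c + ∫ x in a..t, g x := by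
  have hgi : IntervalIntegrable g volume a b := by
    rwa [intervalIntegrable_iff_integrableOn_Ioo_of_le hab.le]
  have hG := hasWeakDerivOn_primitive hab.le hgi 0
  have hGc : ContinuousOn (fun t => ∫ x in a..t, g x) (Set.Icc a b) := by
    have := (hgi.absolutelyContinuousOnInterval_intervalIntegral (c := a) (by simp)).continuousOn
    rwa [Set.uIcc_of_le hab.le] at this
  have hGi : IntegrableOn (fun t => ∫ x in a..t, g x) (Set.Ioo a b) :=
    (hGc.integrableOn_Icc).mono_set Set.Ioo_subset_Icc_self
  obtain ⟨c, hc⟩ := ae_eq_const_of_hasWeakDerivOn_zero hab (hf.sub hGi) (by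
    intro ψ hψ hψc hψs
    have hψ'c : Continuous (deriv ψ) := hψ.continuous_deriv (by exact_mod_cast le_top)
    have hmul : ∀ k : ℝ → ℝ, IntegrableOn k (Set.Ioo a b) →
        IntegrableOn (fun t => k t * deriv ψ t) (Set.Ioo a b) := by
      intro k hk
      obtain ⟨C, hC⟩ := hψc.deriv.exists_bound_of_continuous hψ'c
      exact hk.mul_bdd (c := C) hψ'c.aestronglyMeasurable (Filter.Eventually.of_forall hC)
    have h1 := h ψ hψ hψc hψs
    have h2 := hG ψ hψ hψc hψs
    simp only [zero_add] at h2
    simp only [Pi.sub_apply, Pi.zero_apply, zero_mul, integral_zero, neg_zero, sub_mul]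
    rw [integral_sub (hmul f hf) (hmul _ hGi), h1, h2, sub_self])
  refine ⟨c, ?_⟩
  filter_upwards [hc] with t ht ht'
  have := ht ht'
  simp only [Pi.sub_apply] at this
  linarith

/-- The regularity of `H²(a, b)` functions: on `(a, b)` such a function agrees with a `C¹`
function `u` on the line whose derivative `v` is absolutely continuous on `[a, b]`, with
`v' = w` in `L²`. -/
theorem MemH2.exists_regular {a b : ℝ} (hab : a < b) {f : ℝ → ℝ} (hf : MemH2 a b f) :
    ∃ u v w : ℝ → ℝ, (∀ t, HasDerivAt u (v t) t) ∧ Continuous v ∧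
      AbsolutelyContinuousOnInterval v a b ∧
      MemLp w 2 (volume.restrict (Set.Ioo a b)) ∧ (∀ᵐ t, HasDerivAt v (w t) t) ∧
      ∀ t ∈ Set.Ioo a b, f t = u t := by
  obtain ⟨g₁, g₂, hg₁, hg₂, h₁, h₂⟩ := hf.exists_weakDeriv
  have hi : ∀ {k : ℝ → ℝ}, MemLp k 2 (volume.restrict (Set.Ioo a b)) →
      IntegrableOn k (Set.Ioo a b) := fun hk => hk.integrable (by norm_num)
  obtain ⟨c₁, hc₁⟩ := exists_ae_eq_primitive hab (hi hg₁) (hi hg₂) h₂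
  obtain ⟨c₀, hc₀⟩ := exists_ae_eq_primitive hab (hi hf.memLp) (hi hg₁) h₁
  set w : ℝ → ℝ := (Set.Ioo a b).indicator g₂ with hw
  have hwi : Integrable w := (hi hg₂).integrable_indicator measurableSet_Ioo
  set v : ℝ → ℝ := fun t => c₁ + ∫ x in a..t, w x with hv
  have hvc : Continuous v :=
    continuous_const.add (intervalIntegral.continuous_primitive
      (fun _ _ => hwi.intervalIntegrable) a)
  have hvw : ∀ t ∈ Set.Ioo a b, c₁ + ∫ x in a..t, g₂ x = v t := by
    intro t ht
    simp only [hv]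
    congr 1
    rw [intervalIntegral.integral_of_le ht.1.le, intervalIntegral.integral_of_le ht.1.le]
    refine setIntegral_congr_fun measurableSet_Ioc fun x hx => ?_
    rw [hw, Set.indicator_of_mem]
    exact ⟨hx.1, hx.2.trans_lt ht.2⟩
  set u : ℝ → ℝ := fun t => c₀ + ∫ x in a..t, v x with hu
  have hud : ∀ t, HasDerivAt u (v t) t := fun t =>
    (intervalIntegral.integral_hasDerivAt_right (hvc.intervalIntegrable _ _)
      (hvc.stronglyMeasurableAtFilter _ _) hvc.continuousAt).const_add c₀
  refine ⟨u, v, w, hud, hvc, ?_, ?_, ?_, ?_⟩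
  · have h1 : AbsolutelyContinuousOnInterval (fun _ : ℝ => c₁) a b :=
      (contDiff_const.contDiffOn (s := Set.uIcc a b)).absolutelyContinuousOnInterval
    exact h1.add (hwi.intervalIntegrable.absolutelyContinuousOnInterval_intervalIntegral
      (c := a) (by simp))
  · refine (memLp_congr_ae ?_).2 hg₂
    filter_upwards [ae_restrict_mem measurableSet_Ioo] with t ht
    rw [hw, Set.indicator_of_mem ht]
  · filter_upwards [LocallyIntegrable.ae_hasDerivAt_integral hwi.locallyIntegrable] with t ht
    exact (ht a).const_add c₁
  · have hae : ∀ᵐ t, t ∈ Set.Ioo a b → f t = u t := by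
      filter_upwards [hc₀] with t ht ht'
      rw [ht ht', hu]
      simp only
      congr 1
      rw [intervalIntegral.integral_of_le ht'.1.le, intervalIntegral.integral_of_le ht'.1.le]
      refine integral_congr_ae ?_
      rw [Filter.EventuallyEq, ae_restrict_iff' measurableSet_Ioc]
      filter_upwards [hc₁] with x hx hx'
      have hx'' : x ∈ Set.Ioo a b := ⟨hx'.1, hx'.2.trans_lt ht'.2⟩
      rw [hx hx'', hvw x hx'']
    have huc : Continuous u := continuous_iff_continuousAt.2 fun t => (hud t).continuousAt
    have := Measure.eqOn_open_of_ae_eq (μ := volume) (f := f) (g := u) (U := Set.Ioo a b)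
      (by rwa [Filter.EventuallyEq, ae_restrict_iff' measurableSet_Ioo]) isOpen_Ioo
      hf.continuousOn huc.continuousOn
    exact this

/-! ### The symmetric and skew parts of the conjugated discrete Laplacian -/

/-- The increment `s (φ(t, x_{i+1}) - φ(t, x_i))` of the exponent across the edge
`(x_i, x_{i+1})`, which does not depend on `t`. -/
noncomputable def edgeArg (x₀ s h : ℝ) (i : ℕ) : ℝ := 2 * s * h * ((i + 1 / 2) * h - x₀)

/-- The weight of the edge `(x_i, x_{i+1})` in the symmetric part. -/
noncomputable def edgeCosh (x₀ s h : ℝ) (i : ℕ) : ℝ := Real.cosh (edgeArg x₀ s h i)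

/-- The weight of the edge `(x_i, x_{i+1})` in the skew part. -/
noncomputable def edgeSinh (x₀ s h : ℝ) (i : ℕ) : ℝ := Real.sinh (edgeArg x₀ s h i)

/-- The symmetric part of `e^{sφ} Δ_h e^{-sφ}`, evaluated at the node of index `k + 1`. -/
noncomputable def symOp (x₀ s h : ℝ) (u : ℕ → ℝ) (k : ℕ) : ℝ :=
  (edgeCosh x₀ s h (k + 1) * u (k + 2) + edgeCosh x₀ s h k * u k - 2 * u (k + 1)) / h ^ 2

/-- The opposite of the skew part of `e^{sφ} Δ_h e^{-sφ}`, evaluated at the node of index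
`k + 1`. -/
noncomputable def skewOp (x₀ s h : ℝ) (u : ℕ → ℝ) (k : ℕ) : ℝ :=
  (edgeSinh x₀ s h (k + 1) * u (k + 2) - edgeSinh x₀ s h k * u k) / h ^ 2

/-- The zeroth order coefficient of the symmetric part at the node of index `k + 1`, a discrete
version of `s² |∂_x φ|²`. -/
noncomputable def symPotential (x₀ s h : ℝ) (k : ℕ) : ℝ :=
  (edgeCosh x₀ s h (k + 1) + edgeCosh x₀ s h k - 2) / h ^ 2

theorem sum_mul_sub_add_sum_mul_sub (v e : ℕ → ℝ) (N : ℕ) :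
    ∑ k ∈ Finset.range N, v (k + 1) * (e (k + 1) - e k) +
      ∑ i ∈ Finset.range (N + 1), e i * (v (i + 1) - v i) = v (N + 1) * e N - v 0 * e 0 := by
  induction N with
  | zero => simp; ring
  | succ n ih =>
    rw [Finset.sum_range_succ, Finset.sum_range_succ _ (n + 1)]
    linear_combination ih

section Identities

variable {x₀ s h : ℝ} {N : ℕ} {u v : ℕ → ℝ}

/-- Discrete integration by parts for the symmetric part. -/
theorem sum_mul_symOp (hh : h ≠ 0) (hv0 : v 0 = 0) (hvN : v (N + 1) = 0) :
    ∑ k ∈ Finset.range N, v (k + 1) * symOp x₀ s h u k =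
      -∑ i ∈ Finset.range (N + 1), edgeCosh x₀ s h i * (diffPlus h u i * diffPlus h v i) +
        ∑ k ∈ Finset.range N, symPotential x₀ s h k * (u (k + 1) * v (k + 1)) := by
  have key := sum_mul_sub_add_sum_mul_sub v
    (fun i => edgeCosh x₀ s h i * (u (i + 1) - u i) / h ^ 2) N
  rw [hv0, hvN] at key
  have e1 : ∑ i ∈ Finset.range (N + 1), edgeCosh x₀ s h i * (diffPlus h u i * diffPlus h v i) =
      ∑ i ∈ Finset.range (N + 1),
        edgeCosh x₀ s h i * (u (i + 1) - u i) / h ^ 2 * (v (i + 1) - v i) :=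
    Finset.sum_congr rfl fun i _ => by unfold diffPlus; field_simp
  have e2 : ∑ k ∈ Finset.range N, v (k + 1) * symOp x₀ s h u k =
      ∑ k ∈ Finset.range N, v (k + 1) *
        (edgeCosh x₀ s h (k + 1) * (u (k + 1 + 1) - u (k + 1)) / h ^ 2 -
          edgeCosh x₀ s h k * (u (k + 1) - u k) / h ^ 2) +
        ∑ k ∈ Finset.range N, symPotential x₀ s h k * (u (k + 1) * v (k + 1)) := by
    rw [← Finset.sum_add_distrib]
    refine Finset.sum_congr rfl fun k _ => ?_
    unfold symOp symPotential
    ring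
  rw [e1, e2]
  linarith

theorem sum_mul_symOp_comm (hh : h ≠ 0) (hu0 : u 0 = 0) (huN : u (N + 1) = 0)
    (hv0 : v 0 = 0) (hvN : v (N + 1) = 0) :
    ∑ k ∈ Finset.range N, v (k + 1) * symOp x₀ s h u k =
      ∑ k ∈ Finset.range N, u (k + 1) * symOp x₀ s h v k := by
  rw [sum_mul_symOp hh hv0 hvN, sum_mul_symOp hh hu0 huN]
  congr 1
  · congr 1
    exact Finset.sum_congr rfl fun i _ => by ring
  · exact Finset.sum_congr rfl fun i _ => by ring

theorem sum_mul_skewOp_self (hv0 : v 0 = 0) (hvN : v (N + 1) = 0) :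
    ∑ k ∈ Finset.range N, v (k + 1) * skewOp x₀ s h v k = 0 := by
  have key := Finset.sum_range_sub (fun k => edgeSinh x₀ s h k * v k * v (k + 1) / h ^ 2) N
  simp only [hv0, hvN, mul_zero, zero_mul, zero_div, sub_zero] at key
  rw [← key]
  refine Finset.sum_congr rfl fun k _ => ?_
  unfold skewOp
  ring

theorem edgeArg_succ_sub (k : ℕ) :
    edgeArg x₀ s h (k + 1) - edgeArg x₀ s h k = 2 * s * h ^ 2 := by
  unfold edgeArg
  push_cast
  ring

theorem edgeArg_succ_add (k : ℕ) :
    edgeArg x₀ s h (k + 1) + edgeArg x₀ s h k = 4 * s * h * ((k + 1) * h - x₀) := by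
  unfold edgeArg
  push_cast
  ring

/-- The commutator of the symmetric and skew parts. It is computed exactly thanks to
`sinh a cosh b - cosh a sinh b = sinh (a - b)` and the fact that `edgeArg` is affine. -/
theorem neg_sum_symOp_mul_skewOp (hh : h ≠ 0) (hu0 : u 0 = 0) (huN : u (N + 1) = 0) :
    -∑ k ∈ Finset.range N, symOp x₀ s h u k * skewOp x₀ s h u k =
      (Real.sinh (2 * s * h ^ 2) *
          (∑ k ∈ Finset.range N,
              (Real.cosh (4 * s * h * ((k + 1) * h - x₀)) - 1) * u (k + 1) ^ 2 +
            (∑ k ∈ Finset.range N, (u (k + 2) - u k) ^ 2) / 2 + (u 1 ^ 2 + u N ^ 2) / 2) +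
        edgeCosh x₀ s h 0 * edgeSinh x₀ s h 0 * u 1 ^ 2 -
        edgeCosh x₀ s h N * edgeSinh x₀ s h N * u N ^ 2) / h ^ 4 := by
  set S := Real.sinh (2 * s * h ^ 2) with hS
  have key := Finset.sum_range_sub (fun k =>
    -(edgeCosh x₀ s h k * edgeSinh x₀ s h k * (u k ^ 2 + u (k + 1) ^ 2))
      - S * (u (k + 1) ^ 2 - u k ^ 2) / 2 + 2 * edgeSinh x₀ s h k * u k * u (k + 1)) N
  simp only [hu0, huN] at key
  have hterm : ∀ k ∈ Finset.range N,
      -(h ^ 4 * (symOp x₀ s h u k * skewOp x₀ s h u k)) =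
        S * ((Real.cosh (4 * s * h * ((k + 1) * h - x₀)) - 1) * u (k + 1) ^ 2) +
        S / 2 * (u (k + 2) - u k) ^ 2 +
        ((-(edgeCosh x₀ s h (k + 1) * edgeSinh x₀ s h (k + 1) *
              (u (k + 1) ^ 2 + u (k + 1 + 1) ^ 2))
            - S * (u (k + 1 + 1) ^ 2 - u (k + 1) ^ 2) / 2 +
            2 * edgeSinh x₀ s h (k + 1) * u (k + 1) * u (k + 1 + 1)) -
          (-(edgeCosh x₀ s h k * edgeSinh x₀ s h k * (u k ^ 2 + u (k + 1) ^ 2))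
            - S * (u (k + 1) ^ 2 - u k ^ 2) / 2 +
            2 * edgeSinh x₀ s h k * u k * u (k + 1))) := by
    intro k _
    have hs1 : S = edgeSinh x₀ s h (k + 1) * edgeCosh x₀ s h k -
        edgeCosh x₀ s h (k + 1) * edgeSinh x₀ s h k := by
      rw [hS, ← edgeArg_succ_sub (x₀ := x₀) k, Real.sinh_sub]; rfl
    have hc1 : Real.cosh (4 * s * h * ((k + 1) * h - x₀)) =
        edgeCosh x₀ s h (k + 1) * edgeCosh x₀ s h k +
          edgeSinh x₀ s h (k + 1) * edgeSinh x₀ s h k := by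
      rw [← edgeArg_succ_add, Real.cosh_add]; rfl
    have hp : ∀ i, edgeCosh x₀ s h i ^ 2 - edgeSinh x₀ s h i ^ 2 = 1 := fun i =>
      Real.cosh_sq_sub_sinh_sq _
    have hsc : S * Real.cosh (4 * s * h * ((k + 1) * h - x₀)) =
        edgeCosh x₀ s h (k + 1) * edgeSinh x₀ s h (k + 1) -
          edgeCosh x₀ s h k * edgeSinh x₀ s h k := by
      rw [hs1, hc1]
      linear_combination edgeCosh x₀ s h (k + 1) * edgeSinh x₀ s h (k + 1) * hp k -
        edgeCosh x₀ s h k * edgeSinh x₀ s h k * hp (k + 1)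
    have e : h ^ 4 * (symOp x₀ s h u k * skewOp x₀ s h u k) =
        (edgeCosh x₀ s h (k + 1) * u (k + 2) + edgeCosh x₀ s h k * u k - 2 * u (k + 1)) *
          (edgeSinh x₀ s h (k + 1) * u (k + 2) - edgeSinh x₀ s h k * u k) := by
      unfold symOp skewOp
      field_simp
    rw [e]
    linear_combination -(u (k + 1) ^ 2) * hsc + u (k + 2) * u k * hs1
  have hsum := Finset.sum_congr rfl hterm
  rw [Finset.sum_add_distrib, Finset.sum_add_distrib, key, Finset.sum_neg_distrib,
    ← Finset.mul_sum, ← Finset.mul_sum, ← Finset.mul_sum] at hsum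
  rw [eq_div_iff (pow_ne_zero 4 hh)]
  linear_combination hsum

end Identities

/-! ### Bounds on the coefficients -/

theorem half_sq_le_cosh_sub_one (x : ℝ) : x ^ 2 / 2 ≤ Real.cosh x - 1 := by
  have h1 : Real.cosh x = 1 + 2 * Real.sinh (x / 2) ^ 2 := by
    have := Real.cosh_two_mul (x / 2)
    rw [mul_div_cancel₀ x two_ne_zero, Real.cosh_sq] at this
    linarith
  have h2 : (x / 2) ^ 2 ≤ Real.sinh (x / 2) ^ 2 := by
    rw [sq_le_sq, Real.abs_sinh]
    exact Real.self_le_sinh_iff.2 (abs_nonneg _)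
  rw [h1]
  nlinarith

theorem sinh_sub_sinh_le {x y : ℝ} (hy : 0 ≤ y) (hxy : y ≤ x) :
    Real.sinh x - Real.sinh y ≤ (x - y) * Real.cosh x := by
  rcases hxy.eq_or_lt with rfl | hlt
  · simp
  obtain ⟨c, hc, hd⟩ := exists_hasDerivAt_eq_slope Real.sinh Real.cosh hlt
    Real.continuous_sinh.continuousOn fun z _ => Real.hasDerivAt_sinh z
  have h1 : Real.cosh c ≤ Real.cosh x := by
    rw [Real.cosh_le_cosh, abs_of_nonneg (hy.trans hc.1.le), abs_of_nonneg (hy.trans hxy)]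
    exact hc.2.le
  rw [eq_div_iff (by linarith)] at hd
  nlinarith

theorem sinh_le_mul_cosh {x : ℝ} (hx : 0 ≤ x) : Real.sinh x ≤ x * Real.cosh x := by
  simpa using sinh_sub_sinh_le le_rfl hx

theorem cosh_sub_one_le (x : ℝ) : Real.cosh x - 1 ≤ x ^ 2 / 2 * Real.cosh x := by
  wlog hx : 0 ≤ x generalizing x
  · simpa using this (-x) (by linarith)
  have h1 : Real.cosh x = 2 * Real.cosh (x / 2) ^ 2 - 1 := by
    have := Real.cosh_two_mul (x / 2)
    rw [mul_div_cancel₀ x two_ne_zero, Real.sinh_sq] at this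
    linarith
  have h2 := sinh_le_mul_cosh (x := x / 2) (by linarith)
  have h3 : Real.sinh (x / 2) ^ 2 ≤ (x / 2 * Real.cosh (x / 2)) ^ 2 :=
    pow_le_pow_left₀ (Real.sinh_nonneg_iff.2 (by linarith)) h2 2
  rw [Real.sinh_sq, mul_pow] at h3
  have h4 := Real.one_le_cosh x
  nlinarith [mul_le_mul_of_nonneg_left h4 (sq_nonneg x)]

theorem one_le_edgeCosh (x₀ s h : ℝ) (i : ℕ) : 1 ≤ edgeCosh x₀ s h i := Real.one_le_cosh _

/-- The standing assumptions on the discretization: the mesh has size `h` and lies in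
`(0, R + x₀)`, and `s h` is so small that all symmetric edge weights lie in `[1, 1 + δ]`. -/
structure FineMesh (x₀ s h R δ : ℝ) (N : ℕ) : Prop where
  h_pos : 0 < h
  s_pos : 0 < s
  x₀_neg : x₀ < 0
  length_eq : (N + 1) * h - x₀ = R
  δ_pos : 0 < δ
  δ_le : δ ≤ 1
  cosh_le : Real.cosh (2 * s * h * R) ≤ 1 + δ

namespace FineMesh

variable {x₀ s h R δ : ℝ} {N : ℕ}

theorem R_pos (H : FineMesh x₀ s h R δ N) : 0 < R := by
  have := mul_pos (by positivity : (0 : ℝ) < N + 1) H.h_pos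
  linarith [H.length_eq, H.x₀_neg]

theorem edgeArg_nonneg (H : FineMesh x₀ s h R δ N) (i : ℕ) : 0 ≤ edgeArg x₀ s h i := by
  have h1 := H.h_pos
  have h2 := H.s_pos
  have h3 : 0 ≤ ((i : ℝ) + 1 / 2) * h := by positivity
  exact mul_nonneg (by positivity) (by linarith [H.x₀_neg])

theorem edgeArg_le (H : FineMesh x₀ s h R δ N) {i : ℕ} (hi : i ≤ N) :
    edgeArg x₀ s h i ≤ 2 * s * h * R := by
  have h1 := H.h_pos
  have h2 := H.s_pos
  have h3 : (i : ℝ) ≤ N := by exact_mod_cast hi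
  refine mul_le_mul_of_nonneg_left ?_ (by positivity)
  rw [← H.length_eq]
  nlinarith

theorem edgeCosh_le (H : FineMesh x₀ s h R δ N) {i : ℕ} (hi : i ≤ N) :
    edgeCosh x₀ s h i ≤ 1 + δ := by
  refine le_trans ?_ H.cosh_le
  have h1 := H.edgeArg_nonneg i
  have h2 := H.edgeArg_le hi
  rw [edgeCosh, Real.cosh_le_cosh, abs_of_nonneg h1, abs_of_nonneg (h1.trans h2)]
  exact h2

theorem edgeCosh_sub_one_le (H : FineMesh x₀ s h R δ N) {i : ℕ} (hi : i ≤ N) :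
    edgeCosh x₀ s h i - 1 ≤ 2 * s ^ 2 * h ^ 2 * R ^ 2 * (1 + δ) := by
  refine (cosh_sub_one_le _).trans ?_
  have h3 := H.edgeCosh_le hi
  have h4 := one_le_edgeCosh x₀ s h i
  unfold edgeCosh at h3 h4
  have : edgeArg x₀ s h i ^ 2 ≤ (2 * s * h * R) ^ 2 :=
    pow_le_pow_left₀ (H.edgeArg_nonneg i) (H.edgeArg_le hi) 2
  calc edgeArg x₀ s h i ^ 2 / 2 * Real.cosh (edgeArg x₀ s h i)
      ≤ (2 * s * h * R) ^ 2 / 2 * (1 + δ) := by gcongr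
    _ = _ := by ring

theorem edgeSinh_nonneg (H : FineMesh x₀ s h R δ N) (i : ℕ) : 0 ≤ edgeSinh x₀ s h i :=
  Real.sinh_nonneg_iff.2 (H.edgeArg_nonneg i)

theorem edgeSinh_le (H : FineMesh x₀ s h R δ N) {i : ℕ} (hi : i ≤ N) :
    edgeSinh x₀ s h i ≤ 2 * s * h * R * (1 + δ) := by
  have h1 := H.edgeArg_nonneg i
  have h2 := H.edgeArg_le hi
  have h3 := H.edgeCosh_le hi
  have h4 := one_le_edgeCosh x₀ s h i
  unfold edgeCosh at h3 h4
  refine (sinh_le_mul_cosh h1).trans ?_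
  gcongr
  linarith

theorem abs_edgeSinh_succ_sub_le (H : FineMesh x₀ s h R δ N) {i : ℕ} (hi : i + 1 ≤ N) :
    |edgeSinh x₀ s h (i + 1) - edgeSinh x₀ s h i| ≤ 2 * s * h ^ 2 * (1 + δ) := by
  have h1 := H.edgeArg_nonneg i
  have h2 := edgeArg_succ_sub (x₀ := x₀) (s := s) (h := h) i
  have hs := H.s_pos
  have hh := H.h_pos
  have h5 : 0 < 2 * s * h ^ 2 := by positivity
  have h3 := H.edgeCosh_le hi
  unfold edgeSinh
  rw [abs_of_nonneg (sub_nonneg.2 (Real.sinh_le_sinh.2 (by linarith)))]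
  refine (sinh_sub_sinh_le h1 (by linarith)).trans ?_
  rw [h2]
  exact mul_le_mul_of_nonneg_left h3 h5.le

theorem le_symPotential (H : FineMesh x₀ s h R δ N) {k : ℕ} :
    4 * s ^ 2 * ((k + 1) * h - x₀) ^ 2 ≤ symPotential x₀ s h k := by
  have hh := H.h_pos
  rw [symPotential, le_div_iff₀ (by positivity)]
  have h1 := half_sq_le_cosh_sub_one (edgeArg x₀ s h k)
  have h2 := half_sq_le_cosh_sub_one (edgeArg x₀ s h (k + 1))
  have h3 := edgeArg_succ_add (x₀ := x₀) (s := s) (h := h) k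
  unfold edgeCosh
  have h4 : 4 * s ^ 2 * ((k + 1) * h - x₀) ^ 2 * h ^ 2 =
      (edgeArg x₀ s h (k + 1) + edgeArg x₀ s h k) ^ 2 / 4 := by rw [h3]; ring
  rw [h4]
  nlinarith [sq_nonneg (edgeArg x₀ s h (k + 1) - edgeArg x₀ s h k)]

theorem symPotential_nonneg (H : FineMesh x₀ s h R δ N) {k : ℕ} : 0 ≤ symPotential x₀ s h k :=
  le_trans (by positivity) H.le_symPotential

theorem symPotential_le (H : FineMesh x₀ s h R δ N) {k : ℕ} (hk : k + 1 ≤ N) :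
    symPotential x₀ s h k ≤ 4 * s ^ 2 * R ^ 2 * (1 + δ) := by
  have hh := H.h_pos
  rw [symPotential, div_le_iff₀ (by positivity)]
  have h1 := H.edgeCosh_sub_one_le hk
  have h2 := H.edgeCosh_sub_one_le (i := k) (by omega)
  linarith

/-- The lower bound on the commutator: up to boundary terms it dominates
`16 s³ |x - x₀|² |u|² + 4 s |∂_x u|²`, the derivative being a centered difference. -/
theorem le_neg_sum_symOp_mul_skewOp (H : FineMesh x₀ s h R δ N)
    {u : ℕ → ℝ} (hu0 : u 0 = 0) (huN : u (N + 1) = 0) :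
    16 * s ^ 3 * ∑ k ∈ Finset.range N, ((k + 1) * h - x₀) ^ 2 * u (k + 1) ^ 2 +
      s / h ^ 2 * ∑ k ∈ Finset.range N, (u (k + 2) - u k) ^ 2 +
      2 * s * (h / 2 - x₀) / h * diffPlus h u 0 ^ 2 -
      2 * s * R * (1 + δ) ^ 2 / h * diffPlus h u N ^ 2 ≤
    -∑ k ∈ Finset.range N, symOp x₀ s h u k * skewOp x₀ s h u k := by
  have hh := H.h_pos
  have hs := H.s_pos
  have hR := H.R_pos
  rw [neg_sum_symOp_mul_skewOp hh.ne' hu0 huN, le_div_iff₀ (by positivity)]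
  set S := Real.sinh (2 * s * h ^ 2) with hSdef
  have hS : 2 * s * h ^ 2 ≤ S := Real.self_le_sinh_iff.2 (by positivity)
  have hS0 : 0 ≤ 2 * s * h ^ 2 := by positivity
  set A := ∑ k ∈ Finset.range N, ((k + 1) * h - x₀) ^ 2 * u (k + 1) ^ 2
  set A' := ∑ k ∈ Finset.range N,
    (Real.cosh (4 * s * h * ((k + 1) * h - x₀)) - 1) * u (k + 1) ^ 2
  set B := ∑ k ∈ Finset.range N, (u (k + 2) - u k) ^ 2
  have hB : 0 ≤ B := Finset.sum_nonneg fun _ _ => sq_nonneg _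
  have hA0 : 0 ≤ A := Finset.sum_nonneg fun _ _ => by positivity
  have hA : 8 * s ^ 2 * h ^ 2 * A ≤ A' := by
    rw [Finset.mul_sum]
    refine Finset.sum_le_sum fun k _ => ?_
    have := half_sq_le_cosh_sub_one (4 * s * h * ((k + 1) * h - x₀))
    have h2 := mul_le_mul_of_nonneg_right this (sq_nonneg (u (k + 1)))
    refine le_trans (le_of_eq ?_) h2
    ring
  have hd0 : u 1 = h * diffPlus h u 0 := by
    unfold diffPlus; rw [hu0]; field_simp; simp
  have hdN : u N = -(h * diffPlus h u N) := by
    unfold diffPlus; rw [huN]; field_simp; simp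
  have h0 : edgeArg x₀ s h 0 ≤ edgeCosh x₀ s h 0 * edgeSinh x₀ s h 0 := by
    have h1 := one_le_edgeCosh x₀ s h 0
    have h2 : edgeArg x₀ s h 0 ≤ edgeSinh x₀ s h 0 :=
      Real.self_le_sinh_iff.2 (H.edgeArg_nonneg 0)
    nlinarith [H.edgeSinh_nonneg 0]
  have hN : edgeCosh x₀ s h N * edgeSinh x₀ s h N ≤ (1 + δ) * (2 * s * h * R * (1 + δ)) :=
    mul_le_mul (H.edgeCosh_le le_rfl) (H.edgeSinh_le le_rfl) (H.edgeSinh_nonneg N)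
      (by linarith [H.δ_pos])
  have e0 : edgeArg x₀ s h 0 = 2 * s * h * (h / 2 - x₀) := by
    unfold edgeArg; push_cast; ring
  rw [e0] at h0
  have t1 := mul_le_mul_of_nonneg_right h0 (sq_nonneg (u 1))
  have t2 := mul_le_mul_of_nonneg_right hN (sq_nonneg (u N))
  have t3 : 2 * s * h ^ 2 * (8 * s ^ 2 * h ^ 2 * A + B / 2) ≤
      S * (A' + B / 2 + (u 1 ^ 2 + u N ^ 2) / 2) := by
    refine mul_le_mul hS ?_ (by positivity) (hS0.trans hS)
    nlinarith [sq_nonneg (u 1), sq_nonneg (u N)]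
  rw [hd0] at t1
  rw [hdN] at t2
  rw [hd0, hdN] at t3 ⊢
  have e : (16 * s ^ 3 * A + s / h ^ 2 * B +
      2 * s * (h / 2 - x₀) / h * diffPlus h u 0 ^ 2 -
      2 * s * R * (1 + δ) ^ 2 / h * diffPlus h u N ^ 2) * h ^ 4 =
      2 * s * h ^ 2 * (8 * s ^ 2 * h ^ 2 * A + B / 2) +
      2 * s * h * (h / 2 - x₀) * (h * diffPlus h u 0) ^ 2 -
      (1 + δ) * (2 * s * h * R * (1 + δ)) * (-(h * diffPlus h u N)) ^ 2 := by
    field_simp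
    ring
  rw [e]
  linarith

end FineMesh

/-! ### Discrete norms -/

/-- The sum of squares over the interior nodes. -/
noncomputable def nodeSq (N : ℕ) (u : ℕ → ℝ) : ℝ := ∑ k ∈ Finset.range N, u (k + 1) ^ 2

/-- The sum of the squared difference quotients over all edges, including `(x_0, x_1)`. -/
noncomputable def edgeSq (h : ℝ) (N : ℕ) (u : ℕ → ℝ) : ℝ :=
  ∑ i ∈ Finset.range (N + 1), diffPlus h u i ^ 2

/-- The sum of the squared difference quotients over all edges but the first one. -/
noncomputable def innerEdgeSq (h : ℝ) (N : ℕ) (u : ℕ → ℝ) : ℝ :=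
  ∑ k ∈ Finset.range N, diffPlus h u (k + 1) ^ 2

section Norms

variable {h : ℝ} {N : ℕ} {u v : ℕ → ℝ}

theorem nodeSq_nonneg : 0 ≤ nodeSq N u := Finset.sum_nonneg fun _ _ => sq_nonneg _

theorem edgeSq_nonneg : 0 ≤ edgeSq h N u := Finset.sum_nonneg fun _ _ => sq_nonneg _

theorem innerEdgeSq_nonneg : 0 ≤ innerEdgeSq h N u := Finset.sum_nonneg fun _ _ => sq_nonneg _

theorem edgeSq_eq_innerEdgeSq_add : edgeSq h N u = innerEdgeSq h N u + diffPlus h u 0 ^ 2 :=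
  Finset.sum_range_succ' _ _

theorem innerEdgeSq_le_edgeSq : innerEdgeSq h N u ≤ edgeSq h N u := by
  rw [edgeSq_eq_innerEdgeSq_add]
  exact le_add_of_nonneg_right (sq_nonneg _)

theorem sum_diffPlus_sq_le_edgeSq :
    ∑ k ∈ Finset.range N, diffPlus h u k ^ 2 ≤ edgeSq h N u := by
  rw [edgeSq, Finset.sum_range_succ]
  exact le_add_of_nonneg_right (sq_nonneg _)

theorem sum_sq_left_le_nodeSq (hu0 : u 0 = 0) :
    ∑ k ∈ Finset.range N, u k ^ 2 ≤ nodeSq N u := by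
  have h1 := Finset.sum_range_succ (fun k => u k ^ 2) N
  have h2 := Finset.sum_range_succ' (fun k => u k ^ 2) N
  simp only [hu0] at h2
  unfold nodeSq
  nlinarith [sq_nonneg (u N)]

theorem sum_sq_right_le_nodeSq (huN : u (N + 1) = 0) :
    ∑ k ∈ Finset.range N, u (k + 2) ^ 2 ≤ nodeSq N u := by
  have h1 := Finset.sum_range_succ (fun k => u (k + 1) ^ 2) N
  have h2 := Finset.sum_range_succ' (fun k => u (k + 1) ^ 2) N
  simp only [huN] at h1
  simp only [add_assoc, one_add_one_eq_two] at h1 h2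
  unfold nodeSq
  nlinarith [sq_nonneg (u (0 + 1))]

theorem diffPlus_succ_sub (k : ℕ) :
    diffPlus h u (k + 1) - diffPlus h u k = (u (k + 2) - 2 * u (k + 1) + u k) / h := by
  unfold diffPlus
  ring

theorem sum_second_diff_sq_le :
    ∑ k ∈ Finset.range N, ((u (k + 2) - 2 * u (k + 1) + u k) / h) ^ 2 ≤ 4 * edgeSq h N u := by
  have h1 : ∑ k ∈ Finset.range N, ((u (k + 2) - 2 * u (k + 1) + u k) / h) ^ 2 ≤
      ∑ k ∈ Finset.range N, (2 * diffPlus h u (k + 1) ^ 2 + 2 * diffPlus h u k ^ 2) := by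
    refine Finset.sum_le_sum fun k _ => ?_
    rw [← diffPlus_succ_sub]
    nlinarith [sq_nonneg (diffPlus h u (k + 1) + diffPlus h u k)]
  rw [Finset.sum_add_distrib, ← Finset.mul_sum, ← Finset.mul_sum] at h1
  have h2 := innerEdgeSq_le_edgeSq (h := h) (N := N) (u := u)
  have h3 := sum_diffPlus_sq_le_edgeSq (h := h) (N := N) (u := u)
  unfold innerEdgeSq at h2
  linarith

/-- The defect between centered and one-sided difference quotients. -/
theorem sum_centered_diff_sq :
    (∑ k ∈ Finset.range N, (u (k + 2) - u k) ^ 2) / h ^ 2 =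
      4 * edgeSq h N u - 2 * diffPlus h u 0 ^ 2 - 2 * diffPlus h u N ^ 2 -
        ∑ k ∈ Finset.range N, ((u (k + 2) - 2 * u (k + 1) + u k) / h) ^ 2 := by
  have h1 : (∑ k ∈ Finset.range N, (u (k + 2) - u k) ^ 2) / h ^ 2 =
      ∑ k ∈ Finset.range N, (2 * diffPlus h u (k + 1) ^ 2 + 2 * diffPlus h u k ^ 2 -
        ((u (k + 2) - 2 * u (k + 1) + u k) / h) ^ 2) := by
    rw [Finset.sum_div]
    refine Finset.sum_congr rfl fun k _ => ?_
    unfold diffPlus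
    ring
  rw [h1, Finset.sum_sub_distrib, Finset.sum_add_distrib, ← Finset.mul_sum, ← Finset.mul_sum]
  have h2 := edgeSq_eq_innerEdgeSq_add (h := h) (N := N) (u := u)
  have h3 : edgeSq h N u = ∑ k ∈ Finset.range N, diffPlus h u k ^ 2 + diffPlus h u N ^ 2 :=
    Finset.sum_range_succ _ _
  unfold innerEdgeSq at h2
  linarith

/-- The value at the first node is controlled without the first edge: it is compared with each
of the first `n` nodal values, and the resulting bounds are averaged. -/
theorem first_node_sq_le (hh : h ≠ 0) {n : ℕ} (hn : 0 < n) (hnN : n ≤ N) :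
    v 1 ^ 2 ≤ 2 / n * nodeSq N v + 2 * n * h ^ 2 * innerEdgeSq h N v := by
  have hstep : ∀ k ∈ Finset.range n, v 1 ^ 2 ≤
      2 * v (k + 1) ^ 2 + 2 * n * h ^ 2 * innerEdgeSq h N v := by
    intro k hk
    have hkn := Finset.mem_range.1 hk
    have h1 : v (k + 1) - v 1 = ∑ i ∈ Finset.range k, h * diffPlus h v (i + 1) := by
      have := Finset.sum_range_sub (fun i => v (i + 1)) k
      rw [zero_add] at this
      rw [← this]
      refine Finset.sum_congr rfl fun i _ => ?_
      unfold diffPlus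
      field_simp
    have h2 : (v (k + 1) - v 1) ^ 2 ≤ n * h ^ 2 * innerEdgeSq h N v := by
      rw [h1]
      refine (sq_sum_le_card_mul_sum_sq).trans ?_
      rw [Finset.card_range, mul_assoc]
      refine mul_le_mul (by exact_mod_cast hkn.le) ?_
        (Finset.sum_nonneg fun _ _ => sq_nonneg _) (by positivity)
      rw [innerEdgeSq, Finset.mul_sum]
      simp only [mul_pow]
      exact Finset.sum_le_sum_of_subset_of_nonneg
        (Finset.range_subset_range.2 (by omega)) fun _ _ _ => by positivity
    nlinarith [sq_nonneg (v 1 - 2 * v (k + 1))]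
  have hsum := Finset.sum_le_sum hstep
  rw [Finset.sum_const, Finset.card_range, nsmul_eq_mul, Finset.sum_add_distrib,
    ← Finset.mul_sum, Finset.sum_const, Finset.card_range, nsmul_eq_mul] at hsum
  have hle : ∑ k ∈ Finset.range n, v (k + 1) ^ 2 ≤ nodeSq N v :=
    Finset.sum_le_sum_of_subset_of_nonneg (Finset.range_subset_range.2 hnN)
      fun _ _ _ => sq_nonneg _
  have hn' : (0 : ℝ) < n := by exact_mod_cast hn
  have h3 : (n : ℝ) * v 1 ^ 2 ≤
      n * (2 / n * nodeSq N v + 2 * n * h ^ 2 * innerEdgeSq h N v) := by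
    have e : (n : ℝ) * (2 / n * nodeSq N v + 2 * n * h ^ 2 * innerEdgeSq h N v) =
        2 * nodeSq N v + n * (2 * n * h ^ 2 * innerEdgeSq h N v) := by field_simp
    rw [e]
    linarith
  exact le_of_mul_le_mul_left h3 hn'

end Norms

/-! ### Lower bound for the interior terms -/

namespace FineMesh

variable {x₀ s h R δ : ℝ} {N : ℕ} {u v : ℕ → ℝ}

theorem le_sum_mul_symOp_self (H : FineMesh x₀ s h R δ N) (hu0 : u 0 = 0)
    (huN : u (N + 1) = 0) :
    -(1 + δ) * edgeSq h N u +
        4 * s ^ 2 * ∑ k ∈ Finset.range N, ((k + 1) * h - x₀) ^ 2 * u (k + 1) ^ 2 ≤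
      ∑ k ∈ Finset.range N, u (k + 1) * symOp x₀ s h u k := by
  rw [sum_mul_symOp H.h_pos.ne' hu0 huN]
  refine add_le_add ?_ ?_
  · rw [neg_mul, neg_le_neg_iff, edgeSq, Finset.mul_sum]
    refine Finset.sum_le_sum fun i hi => ?_
    rw [← pow_two]
    exact mul_le_mul_of_nonneg_right
      (H.edgeCosh_le (Nat.lt_succ_iff.1 (Finset.mem_range.1 hi))) (sq_nonneg _)
  · rw [Finset.mul_sum]
    refine Finset.sum_le_sum fun k _ => ?_
    rw [← pow_two, ← mul_assoc]
    exact mul_le_mul_of_nonneg_right H.le_symPotential (sq_nonneg _)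

theorem sum_mul_symOp_self_le (H : FineMesh x₀ s h R δ N) (hu0 : u 0 = 0)
    (huN : u (N + 1) = 0) :
    ∑ k ∈ Finset.range N, u (k + 1) * symOp x₀ s h u k ≤
      -edgeSq h N u + 4 * s ^ 2 * R ^ 2 * (1 + δ) * nodeSq N u := by
  rw [sum_mul_symOp H.h_pos.ne' hu0 huN]
  refine add_le_add ?_ ?_
  · rw [neg_le_neg_iff]
    refine Finset.sum_le_sum fun i _ => ?_
    rw [← pow_two]
    exact le_mul_of_one_le_left (sq_nonneg _) (one_le_edgeCosh x₀ s h i)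
  · rw [nodeSq, Finset.mul_sum]
    refine Finset.sum_le_sum fun k hk => ?_
    rw [← pow_two]
    exact mul_le_mul_of_nonneg_right (H.symPotential_le (Finset.mem_range.1 hk)) (sq_nonneg _)

/-- The symmetric part agrees with the discrete Laplacian up to a small zeroth order term. -/
theorem le_sum_symOp_sq (H : FineMesh x₀ s h R δ N) (hu0 : u 0 = 0) (huN : u (N + 1) = 0) :
    (1 - δ) * ∑ k ∈ Finset.range N, ((u (k + 2) - 2 * u (k + 1) + u k) / h) ^ 2 -
        16 * s ^ 4 * h ^ 2 * R ^ 4 * (1 + δ) ^ 2 / δ * nodeSq N u ≤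
      h ^ 2 * ∑ k ∈ Finset.range N, symOp x₀ s h u k ^ 2 := by
  have hh := H.h_pos
  have hδ := H.δ_pos
  set κ := 2 * s ^ 2 * h ^ 2 * R ^ 2 * (1 + δ) with hκ
  have hterm : ∀ k ∈ Finset.range N,
      (1 - δ) * ((u (k + 2) - 2 * u (k + 1) + u k) / h) ^ 2 -
        2 * κ ^ 2 / (h ^ 2 * δ) * (u (k + 2) ^ 2 + u k ^ 2) ≤ h ^ 2 * symOp x₀ s h u k ^ 2 := by
    intro k hk
    have hk' : k + 1 ≤ N := Finset.mem_range.1 hk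
    set p := (u (k + 2) - 2 * u (k + 1) + u k) / h with hp
    set q := ((edgeCosh x₀ s h (k + 1) - 1) * u (k + 2) + (edgeCosh x₀ s h k - 1) * u k) / h
      with hq
    have e : h ^ 2 * symOp x₀ s h u k ^ 2 = (p + q) ^ 2 := by
      rw [hp, hq]
      unfold symOp
      field_simp
      ring
    have hc1 := H.edgeCosh_sub_one_le hk'
    have hc2 := H.edgeCosh_sub_one_le (i := k) (by omega)
    have hc3 := one_le_edgeCosh x₀ s h k
    have hc4 := one_le_edgeCosh x₀ s h (k + 1)
    have hq2 : q ^ 2 ≤ 2 * κ ^ 2 / h ^ 2 * (u (k + 2) ^ 2 + u k ^ 2) := by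
      rw [hq, div_pow, div_mul_eq_mul_div]
      refine div_le_div_of_nonneg_right ?_ (by positivity)
      have g1 : (edgeCosh x₀ s h (k + 1) - 1) ^ 2 ≤ κ ^ 2 :=
        pow_le_pow_left₀ (by linarith) hc1 2
      have g2 : (edgeCosh x₀ s h k - 1) ^ 2 ≤ κ ^ 2 := pow_le_pow_left₀ (by linarith) hc2 2
      have g3 := mul_le_mul_of_nonneg_right g1 (sq_nonneg (u (k + 2)))
      have g4 := mul_le_mul_of_nonneg_right g2 (sq_nonneg (u k))
      nlinarith [sq_nonneg ((edgeCosh x₀ s h (k + 1) - 1) * u (k + 2) -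
        (edgeCosh x₀ s h k - 1) * u k)]
    have hyoung : (1 - δ) * p ^ 2 - q ^ 2 / δ ≤ (p + q) ^ 2 := by
      have e1 : (p + q) ^ 2 - ((1 - δ) * p ^ 2 - q ^ 2 / δ) =
          (δ * p + q) ^ 2 / δ + q ^ 2 := by field_simp; ring
      have : 0 ≤ (δ * p + q) ^ 2 / δ + q ^ 2 := by positivity
      linarith
    have hq3 : q ^ 2 / δ ≤ 2 * κ ^ 2 / (h ^ 2 * δ) * (u (k + 2) ^ 2 + u k ^ 2) := by
      refine (div_le_div_of_nonneg_right hq2 hδ.le).trans (le_of_eq ?_)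
      field_simp
    rw [e]
    linarith
  have hsum := Finset.sum_le_sum hterm
  rw [Finset.sum_sub_distrib, ← Finset.mul_sum, ← Finset.mul_sum, ← Finset.mul_sum,
    Finset.sum_add_distrib] at hsum
  have h1 := sum_sq_left_le_nodeSq (N := N) hu0
  have h2 := sum_sq_right_le_nodeSq huN
  have h3 : 2 * κ ^ 2 / (h ^ 2 * δ) *
      (∑ k ∈ Finset.range N, u (k + 2) ^ 2 + ∑ k ∈ Finset.range N, u k ^ 2) ≤
      2 * κ ^ 2 / (h ^ 2 * δ) * (nodeSq N u + nodeSq N u) := by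
    gcongr
  have e2 : 2 * κ ^ 2 / (h ^ 2 * δ) * (nodeSq N u + nodeSq N u) =
      16 * s ^ 4 * h ^ 2 * R ^ 4 * (1 + δ) ^ 2 / δ * nodeSq N u := by
    rw [hκ]
    field_simp
    ring
  linarith

/-- Positivity of the purely spatial terms. The multiple `μ h² |symOp u|²` compensates the loss
of high frequencies in the centered differences of the commutator. -/
theorem le_spatial_terms (H : FineMesh x₀ s h R δ N) (hx : h ≤ -x₀) {α μ : ℝ} (hα : 0 ≤ α)
    (hμ : 0 ≤ μ) (hμ1 : μ ≤ 1) (hu0 : u 0 = 0) (huN : u (N + 1) = 0) :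
    s * (4 * μ * (1 - δ) - α * (1 + δ)) * edgeSq h N u +
        s ^ 3 * (4 * α + 16) *
          ∑ k ∈ Finset.range N, ((k + 1) * h - x₀) ^ 2 * u (k + 1) ^ 2 -
        s ^ 3 * (s ^ 2 * h ^ 2) * (64 * R ^ 4 / δ) * nodeSq N u -
        10 * R * s / h * diffPlus h u N ^ 2 ≤
      α * s * ∑ k ∈ Finset.range N, u (k + 1) * symOp x₀ s h u k +
        μ * s * (h ^ 2 * ∑ k ∈ Finset.range N, symOp x₀ s h u k ^ 2) -
        ∑ k ∈ Finset.range N, symOp x₀ s h u k * skewOp x₀ s h u k := by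
  have hh := H.h_pos
  have hs := H.s_pos
  have hδ := H.δ_pos
  have hδ1 := H.δ_le
  have hR := H.R_pos
  have hhR : h ≤ R := by
    have h1 := H.length_eq
    have h2 : (0 : ℝ) ≤ N * h := by positivity
    linarith [H.x₀_neg]
  have a1 := mul_le_mul_of_nonneg_left (H.le_sum_mul_symOp_self hu0 huN)
    (mul_nonneg hα hs.le)
  have a2 := mul_le_mul_of_nonneg_left (H.le_sum_symOp_sq hu0 huN) (mul_nonneg hμ hs.le)
  have a3 := H.le_neg_sum_symOp_mul_skewOp hu0 huN
  have a4 := sum_centered_diff_sq (h := h) (N := N) (u := u)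
  have a5 := sum_second_diff_sq_le (h := h) (N := N) (u := u)
  set Z := ∑ k ∈ Finset.range N, ((u (k + 2) - 2 * u (k + 1) + u k) / h) ^ 2
  set A := ∑ k ∈ Finset.range N, ((k + 1) * h - x₀) ^ 2 * u (k + 1) ^ 2
  set B := ∑ k ∈ Finset.range N, (u (k + 2) - u k) ^ 2
  set D := edgeSq h N u
  set U := nodeSq N u with hU
  have hU0 : 0 ≤ U := nodeSq_nonneg
  have eB : s / h ^ 2 * B = s * (B / h ^ 2) := by ring
  rw [eB, a4] at a3
  have b1 : μ * s * (16 * s ^ 4 * h ^ 2 * R ^ 4 * (1 + δ) ^ 2 / δ * U) ≤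
      s ^ 3 * (s ^ 2 * h ^ 2) * (64 * R ^ 4 / δ) * U := by
    have e1 : μ * s * (16 * s ^ 4 * h ^ 2 * R ^ 4 * (1 + δ) ^ 2 / δ * U) =
        (16 * s ^ 5 * h ^ 2 * R ^ 4 / δ * U) * (μ * (1 + δ) ^ 2) := by ring
    have e2 : s ^ 3 * (s ^ 2 * h ^ 2) * (64 * R ^ 4 / δ) * U =
        (16 * s ^ 5 * h ^ 2 * R ^ 4 / δ * U) * (1 * (1 + 1) ^ 2) := by ring
    rw [e1, e2]
    gcongr
  have b2 : 2 * s * diffPlus h u 0 ^ 2 ≤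
      2 * s * (h / 2 - x₀) / h * diffPlus h u 0 ^ 2 := by
    refine mul_le_mul_of_nonneg_right ?_ (sq_nonneg _)
    rw [le_div_iff₀ hh]
    nlinarith
  have b3 : 2 * s * R * (1 + δ) ^ 2 / h * diffPlus h u N ^ 2 + 2 * s * diffPlus h u N ^ 2 ≤
      10 * R * s / h * diffPlus h u N ^ 2 := by
    rw [← add_mul]
    refine mul_le_mul_of_nonneg_right ?_ (sq_nonneg _)
    have e1 : 2 * s * R * (1 + δ) ^ 2 / h + 2 * s =
        s / h * (2 * R * (1 + δ) ^ 2 + 2 * h) := by field_simp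
    have e2 : 10 * R * s / h = s / h * (10 * R) := by ring
    rw [e1, e2]
    refine mul_le_mul_of_nonneg_left ?_ (by positivity)
    have : (1 + δ) ^ 2 ≤ 4 := by nlinarith
    nlinarith
  have b4 : s * (1 - μ * (1 - δ)) * Z ≤ s * (1 - μ * (1 - δ)) * (4 * D) := by
    refine mul_le_mul_of_nonneg_left a5 (mul_nonneg hs.le ?_)
    nlinarith
  linarith

end FineMesh

/-! ### The interior and boundary forms -/

/-- The sum of squares over the nodes at which `|x - x₀| < β |t|`. -/
noncomputable def obsSq (β x₀ h t : ℝ) (N : ℕ) (u : ℕ → ℝ) : ℝ :=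
  ∑ k ∈ Finset.range N, if (k + 1) * h - x₀ < β * |t| then u (k + 1) ^ 2 else 0

/-- The interior terms in the product of the two parts of the conjugated wave operator, for a
function with value `u` and time derivative `v` at time `t`. -/
noncomputable def bulkForm (β x₀ s h t : ℝ) (N : ℕ) (u v : ℕ → ℝ) : ℝ :=
  (1 - β) * s * nodeSq N v +
    (1 + β) / 2 * s * h ^ 2 * ∑ k ∈ Finset.range N, v (k + 1) * symOp x₀ s h v k -
    (1 + 7 * β) * s * (2 * β * s * t) ^ 2 * nodeSq N u -
    (1 + β) / 2 * s * h ^ 2 * (2 * β * s * t) ^ 2 *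
      ∑ k ∈ Finset.range N, u (k + 1) * symOp x₀ s h u k +
    ((1 + 3 * β) * s * ∑ k ∈ Finset.range N, u (k + 1) * symOp x₀ s h u k +
      (1 + β) / 2 * s * (h ^ 2 * ∑ k ∈ Finset.range N, symOp x₀ s h u k ^ 2) -
      ∑ k ∈ Finset.range N, symOp x₀ s h u k * skewOp x₀ s h u k)

/-- The terms in the product of the two parts of the conjugated wave operator that appear through
their time derivative. -/
noncomputable def boundaryForm (β x₀ s h t : ℝ) (N : ℕ) (u v : ℕ → ℝ) : ℝ :=
  ∑ k ∈ Finset.range N,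
    (2 * β * s * t * v (k + 1) ^ 2 - (1 + β) * s * (v (k + 1) * u (k + 1)) +
      v (k + 1) * skewOp x₀ s h u k + (2 * β * s * t) ^ 3 * u (k + 1) ^ 2 -
      2 * β * s * t * (u (k + 1) * symOp x₀ s h u k) -
      (1 + β) / 2 * s * h ^ 2 * (v (k + 1) * symOp x₀ s h u k))

namespace FineMesh

variable {β x₀ s h t T R δ : ℝ} {N : ℕ} {u v : ℕ → ℝ}

/-- The weighted sum of `|x - x₀|² |u|²` and `t² |u|²` is coercive away from the observed nodes,
where `|x - x₀| ≥ β |t|`. -/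
theorem le_sum_weighted_sq (H : FineMesh x₀ s h R δ N) (hβ0 : 0 < β) (hβ1 : β < 1)
    (ht : |t| ≤ T) :
    16 * (1 - β) * x₀ ^ 2 * nodeSq N u - (32 * T ^ 2 + 16 * x₀ ^ 2) * obsSq β x₀ h t N u ≤
      (20 + 12 * β) * ∑ k ∈ Finset.range N, ((k + 1) * h - x₀) ^ 2 * u (k + 1) ^ 2 -
        (4 + 28 * β) * (β * t) ^ 2 * nodeSq N u := by
  rw [nodeSq, obsSq, Finset.mul_sum, Finset.mul_sum, Finset.mul_sum, Finset.mul_sum,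
    ← Finset.sum_sub_distrib, ← Finset.sum_sub_distrib]
  refine Finset.sum_le_sum fun k _ => ?_
  set r := ((k : ℝ) + 1) * h - x₀ with hr
  have hh := H.h_pos
  have hx := H.x₀_neg
  have hr0 : -x₀ ≤ r := by
    have : 0 ≤ ((k : ℝ) + 1) * h := by positivity
    linarith
  have hr2 : x₀ ^ 2 ≤ r ^ 2 := by nlinarith
  have hbt : (β * t) ^ 2 = (β * |t|) ^ 2 := by rw [mul_pow, mul_pow, sq_abs]
  have hu := sq_nonneg (u (k + 1))
  split_ifs with hobs
  · have h1 : (β * t) ^ 2 ≤ T ^ 2 := by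
      rw [hbt]
      have : β * |t| ≤ T := by nlinarith [abs_nonneg t]
      exact pow_le_pow_left₀ (by positivity) this 2
    have h2 : (4 + 28 * β) * (β * t) ^ 2 ≤ 32 * T ^ 2 := by
      have := sq_nonneg (β * t)
      nlinarith
    have h3 : 16 * (1 - β) * x₀ ^ 2 - (32 * T ^ 2 + 16 * x₀ ^ 2) ≤
        (20 + 12 * β) * r ^ 2 - (4 + 28 * β) * (β * t) ^ 2 := by
      nlinarith [mul_nonneg hβ0.le (sq_nonneg r), mul_nonneg hβ0.le (sq_nonneg x₀), sq_nonneg r]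
    nlinarith [mul_le_mul_of_nonneg_right h3 hu]
  · have h1 : (β * t) ^ 2 ≤ r ^ 2 := by
      rw [hbt]
      exact pow_le_pow_left₀ (by positivity) (not_lt.1 hobs) 2
    have h2 : 16 * (1 - β) * x₀ ^ 2 ≤ (20 + 12 * β) * r ^ 2 - (4 + 28 * β) * (β * t) ^ 2 := by
      have e1 := mul_le_mul_of_nonneg_left h1 (by linarith : (0 : ℝ) ≤ 4 + 28 * β)
      have e2 := mul_le_mul_of_nonneg_left hr2 (by linarith : (0 : ℝ) ≤ 16 * (1 - β))
      nlinarith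
    nlinarith [mul_le_mul_of_nonneg_right h2 hu]

/-- The high-frequency term. The contribution of the first edge is absorbed into the kinetic
energy. -/
theorem le_sum_mul_symOp_of_highFreq (H : FineMesh x₀ s h R δ N) (hβ0 : 0 < β) (hβ1 : β < 1)
    {n : ℕ} (hn : 8 / (1 - β) ≤ n) (hnN : n ≤ N) (hv0 : v 0 = 0) (hvN : v (N + 1) = 0) :
    -((1 - β) / 2 * nodeSq N v) - 6 * n * h ^ 2 * innerEdgeSq h N v ≤
      (1 + β) / 2 * h ^ 2 * ∑ k ∈ Finset.range N, v (k + 1) * symOp x₀ s h v k := by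
  have hh := H.h_pos
  have h1β : 0 < 1 - β := by linarith
  have hn0 : (0 : ℝ) < n := lt_of_lt_of_le (by positivity) hn
  have hn1 : (1 : ℝ) ≤ n := by exact_mod_cast hn0
  have c3 := H.le_sum_mul_symOp_self hv0 hvN
  have c5 := first_node_sq_le (v := v) hh.ne' (by exact_mod_cast hn0) hnN
  set Xv := ∑ k ∈ Finset.range N, v (k + 1) * symOp x₀ s h v k
  set V := nodeSq N v
  set E := innerEdgeSq h N v
  have hV : 0 ≤ V := nodeSq_nonneg
  have hE : 0 ≤ h ^ 2 * E := mul_nonneg (sq_nonneg h) innerEdgeSq_nonneg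
  have hF : 0 ≤ edgeSq h N v := edgeSq_nonneg
  have d2 : h ^ 2 * edgeSq h N v = h ^ 2 * E + v 1 ^ 2 := by
    rw [edgeSq_eq_innerEdgeSq_add, mul_add]
    congr 1
    unfold diffPlus
    rw [hv0]
    field_simp
    simp
  have d3 : 2 / (n : ℝ) * V ≤ (1 - β) / 4 * V := by
    refine mul_le_mul_of_nonneg_right ?_ hV
    rw [div_le_iff₀ h1β] at hn
    rw [div_le_iff₀ hn0]
    linarith
  have e0 : 2 * n * h ^ 2 * E + h ^ 2 * E ≤ 3 * n * (h ^ 2 * E) := by nlinarith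
  have e1 : h ^ 2 * edgeSq h N v ≤ (1 - β) / 4 * V + 3 * n * (h ^ 2 * E) := by linarith
  have e2 : -(2 * edgeSq h N v) ≤ Xv := by
    have g1 : 0 ≤ 4 * s ^ 2 *
        ∑ k ∈ Finset.range N, ((k + 1) * h - x₀) ^ 2 * v (k + 1) ^ 2 :=
      mul_nonneg (by positivity) (Finset.sum_nonneg fun _ _ => by positivity)
    have g2 : (1 + δ) * edgeSq h N v ≤ 2 * edgeSq h N v :=
      mul_le_mul_of_nonneg_right (by linarith [H.δ_le]) hF
    linarith
  have e3 : (1 + β) / 2 * h ^ 2 * -(2 * edgeSq h N v) ≤ (1 + β) / 2 * h ^ 2 * Xv :=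
    mul_le_mul_of_nonneg_left e2 (by positivity)
  have e4 : (1 + β) * (h ^ 2 * edgeSq h N v) ≤ 2 * (h ^ 2 * edgeSq h N v) :=
    mul_le_mul_of_nonneg_right (by linarith) (by positivity)
  linarith

theorem neg_le_sum_mul_symOp_of_time (H : FineMesh x₀ s h R δ N) (hβ0 : 0 < β) (hβ1 : β < 1)
    (ht : |t| ≤ T) (hu0 : u 0 = 0) (huN : u (N + 1) = 0) :
    -(s ^ 3 * (s ^ 2 * h ^ 2) * (32 * R ^ 2 * T ^ 2) * nodeSq N u) ≤
      -((1 + β) / 2 * s * h ^ 2 * (2 * β * s * t) ^ 2 *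
        ∑ k ∈ Finset.range N, u (k + 1) * symOp x₀ s h u k) := by
  have hs := H.s_pos
  have hδ1 := H.δ_le
  have c4 := H.sum_mul_symOp_self_le hu0 huN
  have hD : 0 ≤ edgeSq h N u := edgeSq_nonneg
  have hU : 0 ≤ nodeSq N u := nodeSq_nonneg
  rw [neg_le_neg_iff]
  have e1 : 4 * s ^ 2 * R ^ 2 * (1 + δ) * nodeSq N u ≤
      4 * s ^ 2 * R ^ 2 * (1 + 1) * nodeSq N u := by gcongr
  have e2 : (β * t) ^ 2 ≤ T ^ 2 := by
    rw [← sq_abs, abs_mul, abs_of_pos hβ0]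
    exact pow_le_pow_left₀ (by positivity) (by nlinarith [abs_nonneg t]) 2
  have e3 : (2 * β * s * t) ^ 2 ≤ 4 * s ^ 2 * T ^ 2 := by
    have := mul_le_mul_of_nonneg_left e2 (by positivity : 0 ≤ 4 * s ^ 2)
    linarith
  calc (1 + β) / 2 * s * h ^ 2 * (2 * β * s * t) ^ 2 *
        ∑ k ∈ Finset.range N, u (k + 1) * symOp x₀ s h u k
      ≤ (1 + β) / 2 * s * h ^ 2 * (2 * β * s * t) ^ 2 * (8 * s ^ 2 * R ^ 2 * nodeSq N u) :=
        mul_le_mul_of_nonneg_left (by linarith) (by positivity)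
    _ ≤ 1 * s * h ^ 2 * (4 * s ^ 2 * T ^ 2) * (8 * s ^ 2 * R ^ 2 * nodeSq N u) := by
        gcongr
        linarith
    _ = _ := by ring

/-- Positivity of the interior terms, up to the high-frequency, flux and observation terms. -/
theorem le_bulkForm (H : FineMesh x₀ s h R δ N) (hβ0 : 0 < β) (hβ1 : β < 1) (hx : h ≤ -x₀)
    (ht : |t| ≤ T) {n : ℕ} (hn : 8 / (1 - β) ≤ n) (hnN : n ≤ N) (hδ : δ ≤ (1 - β) / 16)
    (hsh : s ^ 2 * h ^ 2 * (64 * R ^ 4 / δ + 32 * R ^ 2 * T ^ 2) ≤ 8 * (1 - β) * x₀ ^ 2)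
    (hu0 : u 0 = 0) (huN : u (N + 1) = 0) (hv0 : v 0 = 0) (hvN : v (N + 1) = 0) :
    (1 - β) / 2 * s * nodeSq N v + (1 - β) / 2 * s * edgeSq h N u +
        8 * (1 - β) * x₀ ^ 2 * s ^ 3 * nodeSq N u -
        6 * n * s * h ^ 2 * innerEdgeSq h N v - 10 * R * s / h * diffPlus h u N ^ 2 -
        (32 * T ^ 2 + 16 * x₀ ^ 2) * s ^ 3 * obsSq β x₀ h t N u ≤
      bulkForm β x₀ s h t N u v := by
  have hh := H.h_pos
  have hs := H.s_pos
  have hδ0 := H.δ_pos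
  have hδ1 := H.δ_le
  have hR := H.R_pos
  have h1β : 0 < 1 - β := by linarith
  have hs3 : 0 < s ^ 3 := by positivity
  have c1 := H.le_spatial_terms hx (α := 1 + 3 * β) (μ := (1 + β) / 2) (by linarith)
    (by linarith) (by linarith) hu0 huN
  have c2 := mul_le_mul_of_nonneg_left (H.le_sum_weighted_sq hβ0 hβ1 ht (u := u)) hs3.le
  unfold bulkForm
  set A := ∑ k ∈ Finset.range N, ((k + 1) * h - x₀) ^ 2 * u (k + 1) ^ 2
  set X := ∑ k ∈ Finset.range N, u (k + 1) * symOp x₀ s h u k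
  set Xv := ∑ k ∈ Finset.range N, v (k + 1) * symOp x₀ s h v k
  set Y := ∑ k ∈ Finset.range N, symOp x₀ s h u k ^ 2
  set W := ∑ k ∈ Finset.range N, symOp x₀ s h u k * skewOp x₀ s h u k
  set D := edgeSq h N u
  have hD : 0 ≤ D := edgeSq_nonneg
  set U := nodeSq N u
  have hU : 0 ≤ U := nodeSq_nonneg
  set V := nodeSq N v
  set E := innerEdgeSq h N v
  set O := obsSq β x₀ h t N u
  -- the gradient: the coefficient is `1 - β` up to the small parameter `δ`
  have d1 : (1 - β) / 2 * s * D ≤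
      s * (4 * ((1 + β) / 2) * (1 - δ) - (1 + 3 * β) * (1 + δ)) * D := by
    refine mul_le_mul_of_nonneg_right ?_ hD
    rw [mul_comm _ s]
    refine mul_le_mul_of_nonneg_left ?_ hs.le
    nlinarith
  have d4 := mul_le_mul_of_nonneg_left
    (H.le_sum_mul_symOp_of_highFreq hβ0 hβ1 hn hnN hv0 hvN) hs.le
  -- the remaining terms of order `s³ (s h)²`
  have d5 : -(s ^ 3 * (s ^ 2 * h ^ 2) * (32 * R ^ 2 * T ^ 2) * U) ≤
      -((1 + β) / 2 * s * h ^ 2 * (2 * β * s * t) ^ 2 * X) :=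
    H.neg_le_sum_mul_symOp_of_time hβ0 hβ1 ht hu0 huN
  have d6 : s ^ 3 * (s ^ 2 * h ^ 2 * (64 * R ^ 4 / δ + 32 * R ^ 2 * T ^ 2)) * U ≤
      s ^ 3 * (8 * (1 - β) * x₀ ^ 2) * U := by gcongr
  linarith

/-- The skew part is a first order operator with coefficient close to `2 s |x - x₀|`. -/
theorem abs_skewOp_le (H : FineMesh x₀ s h R δ N) {k : ℕ} (hk' : k + 1 ≤ N) :
    |skewOp x₀ s h u k| ≤
      2 * s * R * (1 + δ) * (|diffPlus h u (k + 1)| + |diffPlus h u k|) +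
        4 * s * |u (k + 1)| := by
  have hh := H.h_pos
  have hs := H.s_pos
  have hδ0 := H.δ_pos
  have hδ1 := H.δ_le
  have hR := H.R_pos
  set b := u (k + 1)
  set d' := diffPlus h u (k + 1)
  set d := diffPlus h u k
  have hd' : u (k + 2) = b + h * d' := by
    simp only [b, d', diffPlus]; field_simp; ring
  have hd : u k = b - h * d := by
    simp only [b, d, diffPlus]; field_simp; ring
  have e : skewOp x₀ s h u k = edgeSinh x₀ s h (k + 1) / h * d' +
      edgeSinh x₀ s h k / h * d +
      (edgeSinh x₀ s h (k + 1) - edgeSinh x₀ s h k) / h ^ 2 * b := by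
    rw [skewOp, hd, hd']; field_simp; ring
  have g : ∀ i ≤ N, |edgeSinh x₀ s h i / h| ≤ 2 * s * R * (1 + δ) := by
    intro i hi
    rw [abs_of_nonneg (div_nonneg (H.edgeSinh_nonneg i) hh.le), div_le_iff₀ hh]
    linarith [H.edgeSinh_le hi]
  have g3 : |(edgeSinh x₀ s h (k + 1) - edgeSinh x₀ s h k) / h ^ 2| ≤ 4 * s := by
    rw [abs_div, abs_of_pos (by positivity : 0 < h ^ 2), div_le_iff₀ (by positivity)]
    refine (H.abs_edgeSinh_succ_sub_le hk').trans ?_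
    have : 0 < s * h ^ 2 := by positivity
    nlinarith
  rw [e]
  refine (abs_add_three _ _ _).trans ?_
  rw [abs_mul, abs_mul, abs_mul, mul_add]
  have q1 := mul_le_mul_of_nonneg_right (g (k + 1) hk') (abs_nonneg d')
  have q2 := mul_le_mul_of_nonneg_right (g k (by omega)) (abs_nonneg d)
  have q3 := mul_le_mul_of_nonneg_right g3 (abs_nonneg b)
  linarith

theorem abs_sq_mul_symOp_le (H : FineMesh x₀ s h R δ N) (hsR : s * h * R ≤ 1) {k : ℕ}
    (hk' : k + 1 ≤ N) :
    |h ^ 2 * symOp x₀ s h u k| ≤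
      2 * h * (|diffPlus h u (k + 1)| + |diffPlus h u k|) + 8 * |u (k + 1)| := by
  have hh := H.h_pos
  have hs := H.s_pos
  have hδ0 := H.δ_pos
  have hδ1 := H.δ_le
  have hR := H.R_pos
  set b := u (k + 1)
  set d' := diffPlus h u (k + 1)
  set d := diffPlus h u k
  have hd' : u (k + 2) = b + h * d' := by
    simp only [b, d', diffPlus]; field_simp; ring
  have hd : u k = b - h * d := by
    simp only [b, d, diffPlus]; field_simp; ring
  have e : h ^ 2 * symOp x₀ s h u k = edgeCosh x₀ s h (k + 1) * h * d' +
      -(edgeCosh x₀ s h k * h) * d + h ^ 2 * symPotential x₀ s h k * b := by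
    rw [symOp, symPotential, hd, hd']; field_simp; ring
  have g : ∀ i ≤ N, |edgeCosh x₀ s h i * h| ≤ 2 * h := by
    intro i hi
    have := one_le_edgeCosh x₀ s h i
    rw [abs_of_nonneg (by positivity)]
    nlinarith [H.edgeCosh_le hi]
  have g3 : |h ^ 2 * symPotential x₀ s h k| ≤ 8 := by
    rw [abs_of_nonneg (mul_nonneg (sq_nonneg h) H.symPotential_nonneg)]
    have r1 := mul_le_mul_of_nonneg_left (H.symPotential_le hk') (sq_nonneg h)
    have r2 : (s * h * R) ^ 2 ≤ 1 := pow_le_one₀ (by positivity) hsR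
    have r3 : h ^ 2 * (4 * s ^ 2 * R ^ 2 * (1 + δ)) = 4 * (1 + δ) * (s * h * R) ^ 2 := by
      ring
    nlinarith [sq_nonneg (s * h * R)]
  rw [e]
  refine (abs_add_three _ _ _).trans ?_
  rw [abs_mul, abs_mul (-_), abs_neg, abs_mul (_ * _), mul_add]
  have q1 := mul_le_mul_of_nonneg_right (g (k + 1) hk') (abs_nonneg d')
  have q2 := mul_le_mul_of_nonneg_right (g k (by omega)) (abs_nonneg d)
  have q3 := mul_le_mul_of_nonneg_right g3 (abs_nonneg b)
  linarith

/-- The quadratic form in the boundary terms at a single node, with `X` and `Y` standing for the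
skew and symmetric parts. -/
theorem boundary_node_le {β s h K γ a b d d' X Y : ℝ} (hβ0 : 0 < β) (hβ1 : β < 1) (hs : 0 < s)
    (hh : 0 < h) (hK : 0 < K) (hγ : 0 < γ)
    (f1 : |X| ≤ 2 * s * K * (|d'| + |d|) + 4 * s * |b|)
    (f2 : |h ^ 2 * Y| ≤ 2 * h * (|d'| + |d|) + 8 * |b|) :
    -(2 * (s * (K + h)) + γ * s) * a ^ 2 - s * (K + h) * (d' ^ 2 + d ^ 2) -
        49 * s / γ * b ^ 2 ≤
      -((1 + β) * s * (a * b)) + a * X - (1 + β) / 2 * s * h ^ 2 * (a * Y) := by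
  set P := s * (K + h) with hP
  have p1 : -(|a| * (2 * s * K * (|d'| + |d|) + 4 * s * |b|)) ≤
      a * X := by
    have := mul_le_mul_of_nonneg_left f1 (abs_nonneg a)
    rw [← abs_mul] at this
    linarith [neg_abs_le (a * X)]
  have p2 : (1 + β) / 2 * s * h ^ 2 * (a * Y) ≤
      s * (|a| * (2 * h * (|d'| + |d|) + 8 * |b|)) := by
    have q := mul_le_mul_of_nonneg_left f2 (abs_nonneg a)
    rw [← abs_mul] at q
    have q1 : (1 + β) / 2 * s * h ^ 2 * (a * Y) =
        (1 + β) / 2 * s * (a * (h ^ 2 * Y)) := by ring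
    rw [q1]
    calc (1 + β) / 2 * s * (a * (h ^ 2 * Y))
        ≤ (1 + β) / 2 * s * |a * (h ^ 2 * Y)| :=
          mul_le_mul_of_nonneg_left (le_abs_self _) (by positivity)
      _ ≤ 1 * s * |a * (h ^ 2 * Y)| := by gcongr; linarith
      _ ≤ _ := by rw [one_mul]; exact mul_le_mul_of_nonneg_left q hs.le
  have p3 : (1 + β) * s * (a * b) ≤ 2 * s * (|a| * |b|) := by
    rw [← abs_mul]
    calc (1 + β) * s * (a * b) ≤ (1 + β) * s * |a * b| :=
          mul_le_mul_of_nonneg_left (le_abs_self _) (by positivity)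
      _ ≤ 2 * s * |a * b| := by gcongr; linarith
  have p4 : 14 * s * (|a| * |b|) ≤ γ * s * a ^ 2 + 49 * s / γ * b ^ 2 := by
    have e : γ * s * a ^ 2 + 49 * s / γ * b ^ 2 - 14 * s * (|a| * |b|) =
        s / γ * (γ * |a| - 7 * |b|) ^ 2 := by
      rw [← sq_abs a, ← sq_abs b]; field_simp; ring
    have : 0 ≤ s / γ * (γ * |a| - 7 * |b|) ^ 2 := by positivity
    linarith
  have p5 : 2 * P * (|a| * |d'|) ≤ P * (a ^ 2 + d' ^ 2) := by
    have hP0 : 0 ≤ P := by positivity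
    rw [← sq_abs a, ← sq_abs d']
    nlinarith [mul_nonneg hP0 (sq_nonneg (|a| - |d'|))]
  have p6 : 2 * P * (|a| * |d|) ≤ P * (a ^ 2 + d ^ 2) := by
    have hP0 : 0 ≤ P := by positivity
    rw [← sq_abs a, ← sq_abs d]
    nlinarith [mul_nonneg hP0 (sq_nonneg (|a| - |d|))]
  have p7 : 2 * P * (|a| * |d'|) + 2 * P * (|a| * |d|) =
      |a| * (2 * s * K * (|d'| + |d|)) + s * (|a| * (2 * h * (|d'| + |d|))) := by
    rw [hP]; ring
  linarith

/-- The boundary terms at `t = T` are nonnegative because there `β T > |x - x₀|`, that is,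
`|∂_t φ| > |∂_x φ|`: the weight is time-like. -/
theorem boundaryForm_nonneg (H : FineMesh x₀ s h R δ N) (hβ0 : 0 < β) (hβ1 : β < 1)
    (hT : 0 < T) {γ : ℝ} (hγ : 0 < γ) (hG : R * (1 + δ) + h + γ ≤ β * T)
    (hsR : s * h * R ≤ 1) (hsγ : 3 ≤ s * (β * T) * γ)
    (hu0 : u 0 = 0) (huN : u (N + 1) = 0) : 0 ≤ boundaryForm β x₀ s h T N u v := by
  have hh := H.h_pos
  have hs := H.s_pos
  have hδ0 := H.δ_pos
  have hδ1 := H.δ_le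
  have hR := H.R_pos
  set G := β * T with hGdef
  have hG0 : 0 < G := mul_pos hβ0 hT
  have hτ : 2 * β * s * T = 2 * s * G := by rw [hGdef]; ring
  unfold boundaryForm
  rw [hτ]
  set P := s * (R * (1 + δ) + h) with hP
  have hterm : ∀ k ∈ Finset.range N,
      (2 * s * G - 2 * P - γ * s) * v (k + 1) ^ 2 -
        P * (diffPlus h u (k + 1) ^ 2 + diffPlus h u k ^ 2) +
        ((2 * s * G) ^ 3 - 49 * s / γ) * u (k + 1) ^ 2 -
        2 * s * G * (u (k + 1) * symOp x₀ s h u k) ≤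
      2 * s * G * v (k + 1) ^ 2 - (1 + β) * s * (v (k + 1) * u (k + 1)) +
        v (k + 1) * skewOp x₀ s h u k + (2 * s * G) ^ 3 * u (k + 1) ^ 2 -
        2 * s * G * (u (k + 1) * symOp x₀ s h u k) -
        (1 + β) / 2 * s * h ^ 2 * (v (k + 1) * symOp x₀ s h u k) := by
    intro k hk
    have hk' : k + 1 ≤ N := Finset.mem_range.1 hk
    have key := boundary_node_le (a := v (k + 1)) hβ0 hβ1 hs hh
      (by positivity : 0 < R * (1 + δ)) hγ
      (by rw [← mul_assoc]; exact H.abs_skewOp_le (u := u) hk')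
      (H.abs_sq_mul_symOp_le hsR (u := u) hk')
    rw [← hP] at key
    linarith
  refine le_trans ?_ (Finset.sum_le_sum hterm)
  rw [Finset.sum_sub_distrib, Finset.sum_add_distrib, Finset.sum_sub_distrib, ← Finset.mul_sum,
    ← Finset.mul_sum, ← Finset.mul_sum, ← Finset.mul_sum, Finset.sum_add_distrib]
  have c1 := H.sum_mul_symOp_self_le hu0 huN
  have c2 := innerEdgeSq_le_edgeSq (h := h) (N := N) (u := u)
  have c3 := sum_diffPlus_sq_le_edgeSq (h := h) (N := N) (u := u)
  have hP0 : 0 ≤ P := by positivity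
  have hsG : 0 ≤ 2 * s * G := by positivity
  have hD : 0 ≤ edgeSq h N u := edgeSq_nonneg
  have hU : 0 ≤ nodeSq N u := nodeSq_nonneg
  have hV : 0 ≤ nodeSq N v := nodeSq_nonneg
  have k1 : P + γ * s ≤ s * G := by
    have := mul_le_mul_of_nonneg_left hG hs.le
    rw [hP]
    linarith
  have k2 : 49 * s / γ + 2 * s * G * (4 * s ^ 2 * R ^ 2 * (1 + δ)) ≤ (2 * s * G) ^ 3 := by
    have m0 : 49 * s / γ ≤ 8 * s ^ 3 * G ^ 2 * γ := by
      rw [div_le_iff₀ hγ]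
      have : 3 ^ 2 ≤ (s * G * γ) ^ 2 := pow_le_pow_left₀ (by norm_num) hsγ 2
      have := mul_le_mul_of_nonneg_left this (by positivity : 0 ≤ 8 * s)
      linarith
    have m1 : R * (1 + δ) ≤ G - γ := by linarith
    have m2 : R ≤ G := by linarith [mul_pos hR hδ0]
    have m3 : R ^ 2 * (1 + δ) ≤ G * (G - γ) := by
      have : R * (R * (1 + δ)) ≤ G * (G - γ) := mul_le_mul m2 m1 (by positivity) hG0.le
      linarith
    have m4 := mul_le_mul_of_nonneg_left m3 (by positivity : 0 ≤ 8 * s ^ 3 * G)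
    linarith
  have j1 := mul_le_mul_of_nonneg_left c1 hsG
  have j2 := mul_le_mul_of_nonneg_left (add_le_add c2 c3) hP0
  have j3 := mul_le_mul_of_nonneg_right k2 hU
  have j4 : 0 ≤ (2 * s * G - 2 * P - γ * s) * nodeSq N v :=
    mul_nonneg (by linarith [mul_pos hγ hs]) hV
  have j5 : P * edgeSq h N u ≤ s * G * edgeSq h N u :=
    mul_le_mul_of_nonneg_right (by linarith [mul_pos hγ hs]) hD
  unfold innerEdgeSq at j2
  unfold nodeSq at j1 j3 j4
  linarith

/-- The boundary terms at `t = -T` have the opposite sign. -/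
theorem boundaryForm_neg_nonpos (H : FineMesh x₀ s h R δ N) (hβ0 : 0 < β) (hβ1 : β < 1)
    (hT : 0 < T) {γ : ℝ} (hγ : 0 < γ) (hG : R * (1 + δ) + h + γ ≤ β * T)
    (hsR : s * h * R ≤ 1) (hsγ : 3 ≤ s * (β * T) * γ)
    (hu0 : u 0 = 0) (huN : u (N + 1) = 0) : boundaryForm β x₀ s h (-T) N u v ≤ 0 := by
  have key := H.boundaryForm_nonneg hβ0 hβ1 hT hγ hG hsR hsγ hu0 huN (v := fun i => -v i)
  have e : boundaryForm β x₀ s h T N u (fun i => -v i) =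
      -boundaryForm β x₀ s h (-T) N u v := by
    unfold boundaryForm
    rw [← Finset.sum_neg_distrib]
    exact Finset.sum_congr rfl fun k _ => by ring
  linarith

end FineMesh

/-! ### The product of the two parts of the conjugated wave operator -/

/-- The part `∂_t² + s² |∂_t φ|² - symOp` of the conjugated wave operator at the node `k + 1`, for
a function with value `u` and time derivatives `v`, `w` at time `t`. -/
noncomputable def mainPart (β x₀ s h t : ℝ) (u w : ℕ → ℝ) (k : ℕ) : ℝ :=
  w (k + 1) + (2 * β * s * t) ^ 2 * u (k + 1) - symOp x₀ s h u k

/-- The conjugated wave operator at the node `k + 1`, for a function with value `u` and time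
derivatives `v`, `w` at time `t`. -/
noncomputable def fullOp (β x₀ s h t : ℝ) (u v w : ℕ → ℝ) (k : ℕ) : ℝ :=
  mainPart β x₀ s h t u w k +
    (2 * (2 * β * s * t) * v (k + 1) + 2 * β * s * u (k + 1) + skewOp x₀ s h u k)

/-- The multiplier: the skew part of the conjugated operator, corrected by multiples of `u` and of
`symOp u` that are small compared with the left-hand side of the estimate. -/
noncomputable def multiplier (β x₀ s h t : ℝ) (u v : ℕ → ℝ) (k : ℕ) : ℝ :=
  2 * (2 * β * s * t) * v (k + 1) - (1 + β) * s * u (k + 1) + skewOp x₀ s h u k -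
    (1 + β) / 2 * s * h ^ 2 * symOp x₀ s h u k

/-- The time derivative of `boundaryForm` along a function with value `u` and time derivatives
`v`, `w` at time `t`. -/
noncomputable def boundaryFormDeriv (β x₀ s h t : ℝ) (N : ℕ) (u v w : ℕ → ℝ) : ℝ :=
  ∑ k ∈ Finset.range N,
    (2 * β * s * v (k + 1) ^ 2 + 2 * β * s * t * (2 * v (k + 1) * w (k + 1)) -
      (1 + β) * s * (w (k + 1) * u (k + 1) + v (k + 1) * v (k + 1)) +
      (w (k + 1) * skewOp x₀ s h u k + v (k + 1) * skewOp x₀ s h v k) +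
      (3 * (2 * β * s * t) ^ 2 * (2 * β * s) * u (k + 1) ^ 2 +
        (2 * β * s * t) ^ 3 * (2 * u (k + 1) * v (k + 1))) -
      (2 * β * s * (u (k + 1) * symOp x₀ s h u k) +
        2 * β * s * t * (v (k + 1) * symOp x₀ s h u k + u (k + 1) * symOp x₀ s h v k)) -
      (1 + β) / 2 * s * h ^ 2 *
        (w (k + 1) * symOp x₀ s h u k + v (k + 1) * symOp x₀ s h v k))

section Pointwise

variable {β x₀ s h t T R δ : ℝ} {N : ℕ} {u v w : ℕ → ℝ}

theorem sum_mainPart_mul_multiplier (hh : h ≠ 0) (hu0 : u 0 = 0) (huN : u (N + 1) = 0)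
    (hv0 : v 0 = 0) (hvN : v (N + 1) = 0) :
    ∑ k ∈ Finset.range N, mainPart β x₀ s h t u w k * multiplier β x₀ s h t u v k =
      boundaryFormDeriv β x₀ s h t N u v w + bulkForm β x₀ s h t N u v := by
  have z1 := sum_mul_skewOp_self (x₀ := x₀) (s := s) (h := h) hu0 huN
  have z2 := sum_mul_skewOp_self (x₀ := x₀) (s := s) (h := h) hv0 hvN
  have z3 := sum_mul_symOp_comm (x₀ := x₀) (s := s) hh hu0 huN hv0 hvN
  have e : bulkForm β x₀ s h t N u v = ∑ k ∈ Finset.range N,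
      ((1 - β) * s * v (k + 1) ^ 2 +
        (1 + β) / 2 * s * h ^ 2 * (v (k + 1) * symOp x₀ s h v k) -
        (1 + 7 * β) * s * (2 * β * s * t) ^ 2 * u (k + 1) ^ 2 -
        (1 + β) / 2 * s * h ^ 2 * (2 * β * s * t) ^ 2 * (u (k + 1) * symOp x₀ s h u k) +
        ((1 + 3 * β) * s * (u (k + 1) * symOp x₀ s h u k) +
          (1 + β) / 2 * s * (h ^ 2 * symOp x₀ s h u k ^ 2) -
          symOp x₀ s h u k * skewOp x₀ s h u k)) := by
    simp only [bulkForm, nodeSq, Finset.sum_add_distrib, Finset.sum_sub_distrib, Finset.mul_sum]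
  have e2 : ∑ k ∈ Finset.range N,
      ((2 * β * s * t) ^ 2 * (u (k + 1) * skewOp x₀ s h u k) +
        2 * β * s * t * (u (k + 1) * symOp x₀ s h v k) -
        2 * β * s * t * (v (k + 1) * symOp x₀ s h u k) - v (k + 1) * skewOp x₀ s h v k) = 0 := by
    rw [Finset.sum_sub_distrib, Finset.sum_sub_distrib, Finset.sum_add_distrib,
      ← Finset.mul_sum, ← Finset.mul_sum, ← Finset.mul_sum, z1, z2, z3]
    ring
  rw [e, boundaryFormDeriv, ← Finset.sum_add_distrib, ← sub_eq_zero, ← Finset.sum_sub_distrib,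
    ← e2]
  refine Finset.sum_congr rfl fun k _ => ?_
  unfold mainPart multiplier
  ring

/-- The basic inequality, before using the positivity of the interior terms. -/
theorem FineMesh.boundaryFormDeriv_add_bulkForm_le (H : FineMesh x₀ s h R δ N) (hβ0 : 0 < β)
    (hβ1 : β < 1) (hu0 : u 0 = 0) (huN : u (N + 1) = 0) (hv0 : v 0 = 0) (hvN : v (N + 1) = 0) :
    2 * (boundaryFormDeriv β x₀ s h t N u v w + bulkForm β x₀ s h t N u v) +
        ∑ k ∈ Finset.range N, mainPart β x₀ s h t u w k ^ 2 ≤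
      2 * ∑ k ∈ Finset.range N, fullOp β x₀ s h t u v w k ^ 2 + 208 * s ^ 2 * nodeSq N u := by
  have hh := H.h_pos
  have hs := H.s_pos
  have hδ1 := H.δ_le
  rw [← sum_mainPart_mul_multiplier hh.ne' hu0 huN hv0 hvN]
  have hterm : ∀ k ∈ Finset.range N,
      2 * (mainPart β x₀ s h t u w k * multiplier β x₀ s h t u v k) +
        mainPart β x₀ s h t u w k ^ 2 ≤
      2 * fullOp β x₀ s h t u v w k ^ 2 +
        2 * s ^ 2 * (56 * u (k + 1) ^ 2 + 24 * u (k + 2) ^ 2 + 24 * u k ^ 2) := by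
    intro k hk
    have hk' : k + 1 ≤ N := Finset.mem_range.1 hk
    set p := mainPart β x₀ s h t u w k with hp
    set q := multiplier β x₀ s h t u v k with hq
    set y := h ^ 2 * symOp x₀ s h u k with hy
    set e := (1 + 3 * β) * u (k + 1) + (1 + β) / 2 * y with he
    have hf : fullOp β x₀ s h t u v w k = p + q + s * e := by
      rw [fullOp, ← hp, hq, he, hy, multiplier]
      ring
    have hy2 : y ^ 2 ≤ 12 * (u (k + 1) ^ 2 + u (k + 2) ^ 2 + u k ^ 2) := by
      have ey : y = edgeCosh x₀ s h (k + 1) * u (k + 2) + edgeCosh x₀ s h k * u k -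
          2 * u (k + 1) := by
        rw [hy, symOp]; field_simp
      have g : ∀ i ≤ N, ∀ a : ℝ, (edgeCosh x₀ s h i * a) ^ 2 ≤ 4 * a ^ 2 := by
        intro i hi a
        have g1 := one_le_edgeCosh x₀ s h i
        have g2 : edgeCosh x₀ s h i ≤ 2 := by linarith [H.edgeCosh_le hi]
        have g3 : edgeCosh x₀ s h i ^ 2 ≤ 2 ^ 2 := pow_le_pow_left₀ (by linarith) g2 2
        rw [mul_pow]
        exact mul_le_mul_of_nonneg_right (by linarith) (sq_nonneg a)
      have g1 := g (k + 1) hk' (u (k + 2))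
      have g2 := g k (by omega) (u k)
      rw [ey]
      set A := edgeCosh x₀ s h (k + 1) * u (k + 2)
      set B := edgeCosh x₀ s h k * u k
      nlinarith [sq_nonneg (A - B), sq_nonneg (A + 2 * u (k + 1)), sq_nonneg (B + 2 * u (k + 1))]
    have he2 : e ^ 2 ≤ 56 * u (k + 1) ^ 2 + 24 * u (k + 2) ^ 2 + 24 * u k ^ 2 := by
      have g1 : e ^ 2 ≤ 2 * ((1 + 3 * β) * u (k + 1)) ^ 2 + 2 * ((1 + β) / 2 * y) ^ 2 := by
        rw [he]
        nlinarith [sq_nonneg ((1 + 3 * β) * u (k + 1) - (1 + β) / 2 * y)]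
      have g2 : ((1 + 3 * β) * u (k + 1)) ^ 2 ≤ 16 * u (k + 1) ^ 2 := by
        rw [mul_pow]
        exact mul_le_mul_of_nonneg_right (by nlinarith) (sq_nonneg _)
      have g3 : ((1 + β) / 2 * y) ^ 2 ≤ 1 * y ^ 2 := by
        rw [mul_pow]
        exact mul_le_mul_of_nonneg_right (by nlinarith) (sq_nonneg _)
      linarith
    have hse := mul_le_mul_of_nonneg_left he2 (by positivity : 0 ≤ 2 * s ^ 2)
    rw [hf]
    -- `2 p q + p² ≤ (p + q)²` and `p + q` differs from the full operator by `s e`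
    nlinarith [sq_nonneg q, sq_nonneg (p + q + 2 * (s * e))]
  have hsum := Finset.sum_le_sum hterm
  rw [Finset.sum_add_distrib, Finset.sum_add_distrib, ← Finset.mul_sum, ← Finset.mul_sum,
    ← Finset.mul_sum, Finset.sum_add_distrib, Finset.sum_add_distrib, ← Finset.mul_sum,
    ← Finset.mul_sum, ← Finset.mul_sum] at hsum
  have h1 := sum_sq_left_le_nodeSq (N := N) hu0
  have h2 := sum_sq_right_le_nodeSq huN
  have h3 : 2 * s ^ 2 * (56 * nodeSq N u + 24 * ∑ k ∈ Finset.range N, u (k + 2) ^ 2 +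
      24 * ∑ k ∈ Finset.range N, u k ^ 2) ≤ 2 * s ^ 2 * (104 * nodeSq N u) :=
    mul_le_mul_of_nonneg_left (by linarith) (by positivity)
  unfold nodeSq at h3 ⊢
  linarith

/-- The energy `(|v|² + s² |∂_t φ|² |u|² - ⟨symOp u, u⟩) / 2` associated with the main part of
the conjugated operator. -/
noncomputable def energy (β x₀ s h t : ℝ) (N : ℕ) (u v : ℕ → ℝ) : ℝ :=
  ∑ k ∈ Finset.range N,
    (v (k + 1) ^ 2 + (2 * β * s * t) ^ 2 * u (k + 1) ^ 2 - u (k + 1) * symOp x₀ s h u k) / 2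

/-- The time derivative of `energy`. -/
noncomputable def energyDeriv (β x₀ s h t : ℝ) (N : ℕ) (u v w : ℕ → ℝ) : ℝ :=
  ∑ k ∈ Finset.range N,
    (2 * v (k + 1) * w (k + 1) + (2 * (2 * β * s * t) * (2 * β * s) * u (k + 1) ^ 2 +
      (2 * β * s * t) ^ 2 * (2 * u (k + 1) * v (k + 1))) -
      (v (k + 1) * symOp x₀ s h u k + u (k + 1) * symOp x₀ s h v k)) / 2

theorem energyDeriv_eq (hh : h ≠ 0) (hu0 : u 0 = 0) (huN : u (N + 1) = 0)
    (hv0 : v 0 = 0) (hvN : v (N + 1) = 0) :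
    energyDeriv β x₀ s h t N u v w =
      ∑ k ∈ Finset.range N, mainPart β x₀ s h t u w k * v (k + 1) +
        (2 * β * s) ^ 2 * t * nodeSq N u := by
  have z3 := sum_mul_symOp_comm (x₀ := x₀) (s := s) hh hu0 huN hv0 hvN
  have e2 : ∑ k ∈ Finset.range N,
      ((v (k + 1) * symOp x₀ s h u k) / 2 - (u (k + 1) * symOp x₀ s h v k) / 2) = 0 := by
    rw [Finset.sum_sub_distrib, ← Finset.sum_div, ← Finset.sum_div, z3, sub_self]
  rw [← sub_eq_zero, energyDeriv, nodeSq, Finset.mul_sum, ← Finset.sum_add_distrib,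
    ← Finset.sum_sub_distrib, ← e2]
  refine Finset.sum_congr rfl fun k _ => ?_
  unfold mainPart
  ring

theorem FineMesh.energy_le (H : FineMesh x₀ s h R δ N) (hβ0 : 0 < β) (hβ1 : β < 1)
    (ht : |t| ≤ T) (hu0 : u 0 = 0) (huN : u (N + 1) = 0) :
    energy β x₀ s h t N u v ≤
      nodeSq N v / 2 + 2 * s ^ 2 * T ^ 2 * nodeSq N u + edgeSq h N u := by
  have e : energy β x₀ s h t N u v = nodeSq N v / 2 + (2 * β * s * t) ^ 2 * nodeSq N u / 2 -
      (∑ k ∈ Finset.range N, u (k + 1) * symOp x₀ s h u k) / 2 := by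
    simp only [energy, nodeSq, ← Finset.sum_div, Finset.sum_add_distrib, Finset.sum_sub_distrib,
      Finset.mul_sum]
    ring
  have hU : 0 ≤ nodeSq N u := nodeSq_nonneg
  have hD : 0 ≤ edgeSq h N u := edgeSq_nonneg
  have c := H.le_sum_mul_symOp_self hu0 huN
  have g1 : 0 ≤ 4 * s ^ 2 *
      ∑ k ∈ Finset.range N, ((k + 1) * h - x₀) ^ 2 * u (k + 1) ^ 2 :=
    mul_nonneg (by positivity) (Finset.sum_nonneg fun _ _ => by positivity)
  have g2 : (1 + δ) * edgeSq h N u ≤ 2 * edgeSq h N u :=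
    mul_le_mul_of_nonneg_right (by linarith [H.δ_le]) hD
  have e2 : (β * t) ^ 2 ≤ T ^ 2 := by
    rw [← sq_abs, abs_mul, abs_of_pos hβ0]
    exact pow_le_pow_left₀ (by positivity) (by nlinarith [abs_nonneg t]) 2
  have e3 := mul_le_mul_of_nonneg_right
    (mul_le_mul_of_nonneg_left e2 (by positivity : 0 ≤ 4 * s ^ 2)) hU
  rw [e]
  linarith

/-- The growth of the energy multiplied by the cutoff `1 + t / T` on `(-T, 0)`, with the factor
`q = s^{1/2}`. -/
theorem FineMesh.energy_growth_le (H : FineMesh x₀ s h R δ N) (hβ0 : 0 < β) (hβ1 : β < 1)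
    (hT : 0 < T) (ht : t ∈ Set.Icc (-T) 0) {q : ℝ} (hq0 : 0 ≤ q) (hq : q ^ 2 = s) (hqs : q ≤ s)
    (hu0 : u 0 = 0) (huN : u (N + 1) = 0) (hv0 : v 0 = 0) (hvN : v (N + 1) = 0) :
    q * (1 / T * energy β x₀ s h t N u v + (1 + t / T) * energyDeriv β x₀ s h t N u v w) ≤
      (∑ k ∈ Finset.range N, mainPart β x₀ s h t u w k ^ 2) / 2 +
        (1 / 2 + 1 / T + 2 * T) * (s * (nodeSq N v + edgeSq h N u + s ^ 2 * nodeSq N u)) := by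
  have hs := H.s_pos
  have hU : 0 ≤ nodeSq N u := nodeSq_nonneg
  have hV : 0 ≤ nodeSq N v := nodeSq_nonneg
  have hD : 0 ≤ edgeSq h N u := edgeSq_nonneg
  have hη0 : 0 ≤ 1 + t / T := by
    have : -1 ≤ t / T := by rw [le_div_iff₀ hT]; linarith [ht.1]
    linarith
  have hη1 : 1 + t / T ≤ 1 := by
    have : t / T ≤ 0 := div_nonpos_of_nonpos_of_nonneg ht.2 hT.le
    linarith
  set η := 1 + t / T
  have habs : |t| ≤ T := abs_le.2 ⟨ht.1, ht.2.trans hT.le⟩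
  rw [energyDeriv_eq H.h_pos.ne' hu0 huN hv0 hvN]
  have a1 : q * η * ∑ k ∈ Finset.range N, mainPart β x₀ s h t u w k * v (k + 1) ≤
      (∑ k ∈ Finset.range N, mainPart β x₀ s h t u w k ^ 2) / 2 + s * nodeSq N v / 2 := by
    rw [Finset.mul_sum, nodeSq, Finset.mul_sum, Finset.sum_div, Finset.sum_div,
      ← Finset.sum_add_distrib]
    refine Finset.sum_le_sum fun k _ => ?_
    set p := mainPart β x₀ s h t u w k
    have g1 : η ^ 2 * (q ^ 2 * v (k + 1) ^ 2) ≤ 1 * (q ^ 2 * v (k + 1) ^ 2) :=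
      mul_le_mul_of_nonneg_right (by nlinarith) (by positivity)
    rw [← hq]
    nlinarith [sq_nonneg (p - q * η * v (k + 1))]
  have a2 : q * η * ((2 * β * s) ^ 2 * t * nodeSq N u) ≤ 0 := by
    have : 0 ≤ q * η * ((2 * β * s) ^ 2 * nodeSq N u) := by positivity
    nlinarith [ht.2]
  have a3 : q * (1 / T * energy β x₀ s h t N u v) ≤
      s * (1 / T * (nodeSq N v / 2 + 2 * s ^ 2 * T ^ 2 * nodeSq N u + edgeSq h N u)) := by
    have b1 := mul_le_mul_of_nonneg_left (H.energy_le hβ0 hβ1 habs hu0 huN (v := v))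
      (by positivity : 0 ≤ 1 / T)
    refine (mul_le_mul_of_nonneg_left b1 hq0).trans ?_
    exact mul_le_mul_of_nonneg_right hqs (by positivity)
  have a4 : s * (1 / T * (nodeSq N v / 2 + 2 * s ^ 2 * T ^ 2 * nodeSq N u + edgeSq h N u)) =
      s * (1 / T) * (nodeSq N v / 2 + edgeSq h N u) + 2 * T * (s * (s ^ 2 * nodeSq N u)) := by
    field_simp
    ring
  have b1 : 0 ≤ s * (1 / T) * (nodeSq N v / 2) := by positivity
  have b2 : 0 ≤ s * (1 / T) * (s ^ 2 * nodeSq N u) := by positivity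
  have b3 : 0 ≤ 2 * T * (s * (nodeSq N v + edgeSq h N u)) := by positivity
  have b4 : 0 ≤ s * (edgeSq h N u + s ^ 2 * nodeSq N u) := by positivity
  linarith

end Pointwise

/-! ### Integration in time -/

theorem absolutelyContinuousOnInterval_const (a b c : ℝ) :
    AbsolutelyContinuousOnInterval (fun _ => c) a b :=
  (contDiff_const.contDiffOn (s := Set.uIcc a b)).absolutelyContinuousOnInterval

theorem absolutelyContinuousOnInterval_sum {ι : Type*} {a b : ℝ} (S : Finset ι)
    {f : ι → ℝ → ℝ} (hf : ∀ i ∈ S, AbsolutelyContinuousOnInterval (f i) a b) :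
    AbsolutelyContinuousOnInterval (fun t => ∑ i ∈ S, f i t) a b := by
  classical
  induction S using Finset.induction_on with
  | empty => simpa using absolutelyContinuousOnInterval_const a b 0
  | insert i S hi ih =>
    simp only [Finset.sum_insert hi]
    exact (hf i (Finset.mem_insert_self i S)).fun_add
      (ih fun j hj => hf j (Finset.mem_insert_of_mem hj))

theorem sub_le_integral_of_deriv_le {a b : ℝ} (hab : a ≤ b) {F G g : ℝ → ℝ}
    (hF : AbsolutelyContinuousOnInterval F a b) (hg : IntervalIntegrable g volume a b)
    (hd : ∀ᵐ t, HasDerivAt F (G t) t) (hle : ∀ t ∈ Set.Icc a b, G t ≤ g t) :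
    F b - F a ≤ ∫ t in a..b, g t := by
  rw [← hF.integral_deriv_eq_sub]
  refine intervalIntegral.integral_mono_ae_restrict hab hF.intervalIntegrable_deriv hg ?_
  rw [Filter.EventuallyLE, ae_restrict_iff' measurableSet_Icc]
  filter_upwards [hd] with t ht hmem
  rw [ht.deriv]
  exact hle t hmem

theorem intervalIntegrable_sum {ι : Type*} {a b : ℝ} {S : Finset ι} {f : ι → ℝ → ℝ}
    (hf : ∀ i ∈ S, IntervalIntegrable (f i) volume a b) :
    IntervalIntegrable (fun t => ∑ i ∈ S, f i t) volume a b := by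
  simp only [intervalIntegrable_iff] at hf ⊢
  exact integrable_finsetSum S hf

theorem intervalIntegrable_add_sq {a b : ℝ} (hab : a ≤ b) {c w : ℝ → ℝ} (hc : Continuous c)
    (hw : MemLp w 2 (volume.restrict (Set.Ioo a b))) :
    IntervalIntegrable (fun t => (w t + c t) ^ 2) volume a b := by
  have h2 : IntervalIntegrable (fun t => w t ^ 2) volume a b := by
    rw [intervalIntegrable_iff_integrableOn_Ioo_of_le hab]
    exact hw.integrable_sq
  have h1 : IntervalIntegrable w volume a b := by
    rw [intervalIntegrable_iff_integrableOn_Ioo_of_le hab]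
    exact hw.integrable (by norm_num)
  have h3 : IntervalIntegrable (fun t => w t * c t) volume a b :=
    h1.mul_continuousOn hc.continuousOn
  have h4 : IntervalIntegrable (fun t => c t ^ 2) volume a b :=
    (hc.pow 2).intervalIntegrable _ _
  refine ((h2.add (h3.const_mul 2)).add h4).congr ?_
  intro t _
  beta_reduce
  ring

/-- A mesh function `u` of time with time derivatives `v` (absolutely continuous on `[a, b]`) and
`w` (square integrable on `(a, b)`), vanishing at both ends of the mesh. -/
structure RegularPath (a b : ℝ) (N : ℕ) (u v w : ℕ → ℝ → ℝ) : Prop where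
  hasDerivAt : ∀ j t, HasDerivAt (u j) (v j t) t
  continuous : ∀ j, Continuous (v j)
  ac : ∀ j, AbsolutelyContinuousOnInterval (v j) a b
  memLp : ∀ j, MemLp (w j) 2 (volume.restrict (Set.Ioo a b))
  ae_hasDerivAt : ∀ᵐ t, ∀ j, HasDerivAt (v j) (w j t) t
  u_first : ∀ t, u 0 t = 0
  u_last : ∀ t, u (N + 1) t = 0
  v_first : ∀ t, v 0 t = 0
  v_last : ∀ t, v (N + 1) t = 0

namespace RegularPath

variable {a b β x₀ s h : ℝ} {N : ℕ} {u v w : ℕ → ℝ → ℝ}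

theorem continuous_u (P : RegularPath a b N u v w) (j : ℕ) : Continuous (u j) :=
  continuous_iff_continuousAt.2 fun t => (P.hasDerivAt j t).continuousAt

theorem ac_u (P : RegularPath a b N u v w) (j : ℕ) :
    AbsolutelyContinuousOnInterval (u j) a b := by
  refine ContDiffOn.absolutelyContinuousOnInterval (ContDiff.contDiffOn ?_)
  rw [contDiff_one_iff_deriv]
  refine ⟨fun t => (P.hasDerivAt j t).differentiableAt, ?_⟩
  rw [show deriv (u j) = v j from funext fun t => (P.hasDerivAt j t).deriv]
  exact P.continuous j

theorem ac_symOp {f : ℕ → ℝ → ℝ} (hf : ∀ j, AbsolutelyContinuousOnInterval (f j) a b) (k : ℕ) :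
    AbsolutelyContinuousOnInterval (fun t => symOp x₀ s h (fun j => f j t) k) a b := by
  have := ((((hf (k + 2)).const_mul (edgeCosh x₀ s h (k + 1))).fun_add
    ((hf k).const_mul (edgeCosh x₀ s h k))).fun_sub ((hf (k + 1)).const_mul 2)).const_mul
      (1 / h ^ 2)
  convert this using 2 with t
  simp only [symOp]
  ring

theorem ac_skewOp {f : ℕ → ℝ → ℝ} (hf : ∀ j, AbsolutelyContinuousOnInterval (f j) a b) (k : ℕ) :
    AbsolutelyContinuousOnInterval (fun t => skewOp x₀ s h (fun j => f j t) k) a b := by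
  have := (((hf (k + 2)).const_mul (edgeSinh x₀ s h (k + 1))).fun_sub
    ((hf k).const_mul (edgeSinh x₀ s h k))).const_mul (1 / h ^ 2)
  convert this using 2 with t
  simp only [skewOp]
  ring

theorem hasDerivAt_symOp {f f' : ℕ → ℝ → ℝ} {t : ℝ} (hf : ∀ j, HasDerivAt (f j) (f' j t) t)
    (k : ℕ) :
    HasDerivAt (fun t => symOp x₀ s h (fun j => f j t) k)
      (symOp x₀ s h (fun j => f' j t) k) t := by
  exact ((((hf (k + 2)).const_mul _).add ((hf k).const_mul _)).sub
    ((hf (k + 1)).const_mul 2)).div_const _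

theorem hasDerivAt_skewOp {f f' : ℕ → ℝ → ℝ} {t : ℝ} (hf : ∀ j, HasDerivAt (f j) (f' j t) t)
    (k : ℕ) :
    HasDerivAt (fun t => skewOp x₀ s h (fun j => f j t) k)
      (skewOp x₀ s h (fun j => f' j t) k) t := by
  exact (((hf (k + 2)).const_mul _).sub ((hf k).const_mul _)).div_const _

theorem ac_linear (c : ℝ) : AbsolutelyContinuousOnInterval (fun t => c * t) a b :=
  ((contDiff_const.mul contDiff_id).contDiffOn (s := Set.uIcc a b)).absolutelyContinuousOnInterval

theorem ac_boundaryForm (P : RegularPath a b N u v w) :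
    AbsolutelyContinuousOnInterval
      (fun t => boundaryForm β x₀ s h t N (fun j => u j t) (fun j => v j t)) a b := by
  refine absolutelyContinuousOnInterval_sum _ fun k _ => ?_
  have hτ : AbsolutelyContinuousOnInterval (fun t => 2 * β * s * t) a b := ac_linear _
  have hu := P.ac_u (k + 1)
  have hv := P.ac (k + 1)
  have hS := ac_symOp (x₀ := x₀) (s := s) (h := h) P.ac_u k
  have hB := ac_skewOp (x₀ := x₀) (s := s) (h := h) P.ac_u k
  simp only [pow_succ, pow_zero, one_mul]
  exact (((((hτ.fun_mul (hv.fun_mul hv)).fun_sub ((hv.fun_mul hu).const_mul _)).fun_add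
    (hv.fun_mul hB)).fun_add (((hτ.fun_mul hτ).fun_mul hτ).fun_mul (hu.fun_mul hu))).fun_sub
    (hτ.fun_mul (hu.fun_mul hS))).fun_sub ((hv.fun_mul hS).const_mul _)

theorem hasDerivAt_boundaryForm (P : RegularPath a b N u v w) {t : ℝ}
    (ht : ∀ j, HasDerivAt (v j) (w j t) t) :
    HasDerivAt (fun t => boundaryForm β x₀ s h t N (fun j => u j t) (fun j => v j t))
      (boundaryFormDeriv β x₀ s h t N (fun j => u j t) (fun j => v j t) (fun j => w j t)) t := by
  refine HasDerivAt.fun_sum fun k _ => ?_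
  have hτ : HasDerivAt (fun t => 2 * β * s * t) (2 * β * s) t := by
    simpa using (hasDerivAt_id t).const_mul (2 * β * s)
  have hu := P.hasDerivAt (k + 1) t
  have hv := ht (k + 1)
  have hS := hasDerivAt_symOp (x₀ := x₀) (s := s) (h := h) (f := u) (f' := v)
    (fun j => P.hasDerivAt j t) k
  have hB := hasDerivAt_skewOp (x₀ := x₀) (s := s) (h := h) (f := u) (f' := v)
    (fun j => P.hasDerivAt j t) k
  have key := (((((hτ.mul (hv.pow 2)).sub ((hv.mul hu).const_mul ((1 + β) * s))).add
    (hv.mul hB)).add ((hτ.pow 3).mul (hu.pow 2))).sub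
    (hτ.mul (hu.mul hS))).sub ((hv.mul hS).const_mul ((1 + β) / 2 * s * h ^ 2))
  refine (key.congr_deriv ?_)
  simp only [Pi.pow_apply, Pi.mul_apply]
  push_cast
  ring

theorem ac_energy (P : RegularPath a b N u v w) :
    AbsolutelyContinuousOnInterval
      (fun t => energy β x₀ s h t N (fun j => u j t) (fun j => v j t)) a b := by
  refine absolutelyContinuousOnInterval_sum _ fun k _ => ?_
  have hτ : AbsolutelyContinuousOnInterval (fun t => 2 * β * s * t) a b := ac_linear _
  have hu := P.ac_u (k + 1)
  have hv := P.ac (k + 1)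
  have hS := ac_symOp (x₀ := x₀) (s := s) (h := h) P.ac_u k
  have := (((hv.fun_mul hv).fun_add ((hτ.fun_mul hτ).fun_mul (hu.fun_mul hu))).fun_sub
    (hu.fun_mul hS)).const_mul (1 / 2)
  convert this using 2 with t
  ring

theorem hasDerivAt_energy (P : RegularPath a b N u v w) {t : ℝ}
    (ht : ∀ j, HasDerivAt (v j) (w j t) t) :
    HasDerivAt (fun t => energy β x₀ s h t N (fun j => u j t) (fun j => v j t))
      (energyDeriv β x₀ s h t N (fun j => u j t) (fun j => v j t) (fun j => w j t)) t := by
  refine HasDerivAt.fun_sum fun k _ => ?_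
  have hτ : HasDerivAt (fun t => 2 * β * s * t) (2 * β * s) t := by
    simpa using (hasDerivAt_id t).const_mul (2 * β * s)
  have hu := P.hasDerivAt (k + 1) t
  have hv := ht (k + 1)
  have hS := hasDerivAt_symOp (x₀ := x₀) (s := s) (h := h) (f := u) (f' := v)
    (fun j => P.hasDerivAt j t) k
  have key := (((hv.pow 2).add ((hτ.pow 2).mul (hu.pow 2))).sub (hu.mul hS)).div_const 2
  refine (key.congr_deriv ?_)
  simp only [Pi.pow_apply]
  push_cast
  ring

theorem continuous_symOp (P : RegularPath a b N u v w) (k : ℕ) :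
    Continuous fun t => symOp x₀ s h (fun j => u j t) k := by
  have := P.continuous_u
  unfold symOp
  fun_prop

theorem continuous_skewOp (P : RegularPath a b N u v w) (k : ℕ) :
    Continuous fun t => skewOp x₀ s h (fun j => u j t) k := by
  have := P.continuous_u
  unfold skewOp
  fun_prop

theorem intervalIntegrable_mainPart (P : RegularPath a b N u v w) (hab : a ≤ b) :
    IntervalIntegrable (fun t => ∑ k ∈ Finset.range N,
      mainPart β x₀ s h t (fun j => u j t) (fun j => w j t) k ^ 2) volume a b := by
  refine intervalIntegrable_sum fun k _ => ?_
  have hS := P.continuous_symOp (x₀ := x₀) (s := s) (h := h) k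
  have hu := P.continuous_u (k + 1)
  have := intervalIntegrable_add_sq hab (w := w (k + 1))
    (c := fun t => (2 * β * s * t) ^ 2 * u (k + 1) t - symOp x₀ s h (fun j => u j t) k)
    (by fun_prop) (P.memLp (k + 1))
  refine this.congr ?_
  intro t _
  simp only [mainPart]
  ring

theorem intervalIntegrable_fullOp (P : RegularPath a b N u v w) (hab : a ≤ b) :
    IntervalIntegrable (fun t => ∑ k ∈ Finset.range N,
      fullOp β x₀ s h t (fun j => u j t) (fun j => v j t) (fun j => w j t) k ^ 2)
      volume a b := by
  refine intervalIntegrable_sum fun k _ => ?_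
  have hS := P.continuous_symOp (x₀ := x₀) (s := s) (h := h) k
  have hB := P.continuous_skewOp (x₀ := x₀) (s := s) (h := h) k
  have hu := P.continuous_u (k + 1)
  have hv := P.continuous (k + 1)
  have := intervalIntegrable_add_sq hab (w := w (k + 1))
    (c := fun t => (2 * β * s * t) ^ 2 * u (k + 1) t - symOp x₀ s h (fun j => u j t) k +
      (2 * (2 * β * s * t) * v (k + 1) t + 2 * β * s * u (k + 1) t +
        skewOp x₀ s h (fun j => u j t) k))
    (by fun_prop) (P.memLp (k + 1))
  refine this.congr ?_
  intro t _
  simp only [fullOp, mainPart]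
  ring

theorem continuous_nodeSq (f : ℕ → ℝ → ℝ) (hf : ∀ j, Continuous (f j)) :
    Continuous fun t => nodeSq N (fun j => f j t) := by
  unfold nodeSq
  fun_prop

theorem continuous_edgeSq (f : ℕ → ℝ → ℝ) (hf : ∀ j, Continuous (f j)) :
    Continuous fun t => edgeSq h N (fun j => f j t) := by
  unfold edgeSq diffPlus
  fun_prop

theorem continuous_innerEdgeSq (f : ℕ → ℝ → ℝ) (hf : ∀ j, Continuous (f j)) :
    Continuous fun t => innerEdgeSq h N (fun j => f j t) := by
  unfold innerEdgeSq diffPlus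
  fun_prop

theorem intervalIntegrable_obsSq (P : RegularPath a b N u v w) :
    IntervalIntegrable (fun t => obsSq β x₀ h t N (fun j => u j t)) volume a b := by
  refine intervalIntegrable_sum fun k _ => ?_
  have hm : MeasurableSet {t : ℝ | ((k : ℝ) + 1) * h - x₀ < β * |t|} :=
    (isOpen_lt continuous_const (by fun_prop)).measurableSet
  have hi : IntervalIntegrable (fun t => u (k + 1) t ^ 2) volume a b :=
    ((P.continuous_u (k + 1)).pow 2).intervalIntegrable _ _
  rw [intervalIntegrable_iff] at hi ⊢
  refine (hi.indicator hm).congr ?_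
  filter_upwards with t
  simp only [Set.indicator_apply, Set.mem_ofPred_eq]

end RegularPath

/-! ### The estimate for regular paths -/

/-- The density of the left-hand side of the estimate, without the factor `s h`. It includes the
first mesh edge, which the estimate itself leaves out. -/
noncomputable def lhsDensity (s h : ℝ) (N : ℕ) (u v : ℕ → ℝ) : ℝ :=
  nodeSq N v + edgeSq h N u + s ^ 2 * nodeSq N u

/-- The density of the right-hand side of the estimate, without the factor `M h`; this is why the
flux term carries a factor `1 / h`. -/
noncomputable def rhsDensity (β x₀ s h t : ℝ) (N : ℕ) (u v w : ℕ → ℝ) : ℝ :=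
  ∑ k ∈ Finset.range N, fullOp β x₀ s h t u v w k ^ 2 + s / h * diffPlus h u N ^ 2 +
    s ^ 3 * obsSq β x₀ h t N u + s * h ^ 2 * innerEdgeSq h N v

/-- The constraints that relate the parameter `s` and the mesh size to the geometry: `n` bounds
the number of nodes from below, `c` is the coercivity constant of the interior terms and `γ`
bounds from below the gap between `β T` and `|x - x₀|`. -/
structure Admissible (β x₀ s h T R δ γ c : ℝ) (n N : ℕ) : Prop extends
    FineMesh x₀ s h R δ N where
  β_pos : 0 < β
  β_lt_one : β < 1
  T_pos : 0 < T
  γ_pos : 0 < γ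
  le_n : 8 / (1 - β) ≤ n
  n_le : n ≤ N
  δ_le_sub : δ ≤ (1 - β) / 16
  h_le : h ≤ -x₀
  gap : R * (1 + δ) + h + γ ≤ β * T
  small : s ^ 2 * h ^ 2 * (64 * R ^ 4 / δ + 32 * R ^ 2 * T ^ 2) ≤ 8 * (1 - β) * x₀ ^ 2
  small_R : s * h * R ≤ 1
  large_γ : 3 ≤ s * (β * T) * γ
  one_le_s : 1 ≤ s
  c_le_sub : c ≤ (1 - β) / 2
  c_le_x₀ : c ≤ 8 * (1 - β) * x₀ ^ 2
  large_c : 208 ≤ c * s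

namespace Admissible

variable {β x₀ s h t T R δ γ c : ℝ} {n N : ℕ}

/-- The Carleman estimate before integration in time. -/
theorem pointwise (A : Admissible β x₀ s h T R δ γ c n N) (ht : |t| ≤ T) {u v w : ℕ → ℝ}
    (hu0 : u 0 = 0) (huN : u (N + 1) = 0) (hv0 : v 0 = 0) (hvN : v (N + 1) = 0) :
    2 * boundaryFormDeriv β x₀ s h t N u v w +
        ∑ k ∈ Finset.range N, mainPart β x₀ s h t u w k ^ 2 + c * (s * lhsDensity s h N u v) ≤
      (2 + 12 * n + 20 * R + 2 * (32 * T ^ 2 + 16 * x₀ ^ 2)) *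
        rhsDensity β x₀ s h t N u v w := by
  have H := A.toFineMesh
  have hs := A.s_pos
  have hh := A.h_pos
  have hR := H.R_pos
  have c1 := H.boundaryFormDeriv_add_bulkForm_le (t := t) (w := w) A.β_pos A.β_lt_one
    hu0 huN hv0 hvN
  have c2 := H.le_bulkForm A.β_pos A.β_lt_one A.h_le ht A.le_n A.n_le A.δ_le_sub A.small
    hu0 huN hv0 hvN
  unfold lhsDensity rhsDensity
  set V := nodeSq N v
  set U := nodeSq N u
  set D := edgeSq h N u
  set E := innerEdgeSq h N v
  set F := ∑ k ∈ Finset.range N, fullOp β x₀ s h t u v w k ^ 2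
  set O := obsSq β x₀ h t N u
  have hV : 0 ≤ s * V := mul_nonneg hs.le nodeSq_nonneg
  have hU : 0 ≤ s ^ 2 * U := mul_nonneg (by positivity) nodeSq_nonneg
  have hU3 : 0 ≤ s ^ 3 * U := mul_nonneg (by positivity) nodeSq_nonneg
  have hD : 0 ≤ s * D := mul_nonneg hs.le edgeSq_nonneg
  have hE : 0 ≤ s * h ^ 2 * E := mul_nonneg (by positivity) innerEdgeSq_nonneg
  have hF : 0 ≤ F := Finset.sum_nonneg fun _ _ => sq_nonneg _
  have hO : 0 ≤ s ^ 3 * O := mul_nonneg (by positivity)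
    (Finset.sum_nonneg fun k _ => by split_ifs <;> positivity)
  have hd : 0 ≤ s / h * diffPlus h u N ^ 2 := by positivity
  set d := s / h * diffPlus h u N ^ 2 with hddef
  have hd' : 10 * R * s / h * diffPlus h u N ^ 2 = 10 * R * d := by rw [hddef]; ring
  rw [hd'] at c2
  have e1 : c * (s * V) ≤ (1 - β) / 2 * (s * V) := mul_le_mul_of_nonneg_right A.c_le_sub hV
  have e2 : c * (s * D) ≤ (1 - β) / 2 * (s * D) := mul_le_mul_of_nonneg_right A.c_le_sub hD
  have e3 : c * (s ^ 3 * U) ≤ 8 * (1 - β) * x₀ ^ 2 * (s ^ 3 * U) :=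
    mul_le_mul_of_nonneg_right A.c_le_x₀ hU3
  have e4 : 208 * (s ^ 2 * U) ≤ c * s * (s ^ 2 * U) := mul_le_mul_of_nonneg_right A.large_c hU
  have e5 : 0 ≤ (1 - β) / 2 * (s * V) := mul_nonneg (by linarith [A.β_lt_one]) hV
  have e6 : 0 ≤ (1 - β) / 2 * (s * D) := mul_nonneg (by linarith [A.β_lt_one]) hD
  set C := 32 * T ^ 2 + 16 * x₀ ^ 2 with hC
  have hC0 : 0 ≤ C := by positivity
  have f1 : 2 * F + 12 * n * (s * h ^ 2 * E) + 20 * R * d + 2 * C * (s ^ 3 * O) ≤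
      (2 + 12 * n + 20 * R + 2 * C) * (F + d + s ^ 3 * O + s * h ^ 2 * E) := by
    have g1 : 0 ≤ (12 * n + 20 * R + 2 * C) * F := by positivity
    have g2 : 0 ≤ (2 + 20 * R + 2 * C) * (s * h ^ 2 * E) := mul_nonneg (by positivity) hE
    have g3 : 0 ≤ (2 + 12 * n + 2 * C) * d := by positivity
    have g4 : 0 ≤ (2 + 12 * n + 20 * R) * (s ^ 3 * O) := mul_nonneg (by positivity) hO
    linarith
  refine le_trans ?_ f1
  linarith

variable {u v w : ℕ → ℝ → ℝ}

theorem intervalIntegrable_lhsDensity {a b : ℝ} (P : RegularPath a b N u v w) (p q : ℝ) :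
    IntervalIntegrable (fun t => lhsDensity s h N (fun j => u j t) (fun j => v j t))
      volume p q := by
  have h1 := RegularPath.continuous_nodeSq (N := N) u P.continuous_u
  have h2 := RegularPath.continuous_nodeSq (N := N) v P.continuous
  have h3 := RegularPath.continuous_edgeSq (h := h) (N := N) u P.continuous_u
  unfold lhsDensity
  exact Continuous.intervalIntegrable (by fun_prop) _ _

theorem intervalIntegrable_rhsDensity {a b : ℝ} (P : RegularPath a b N u v w) (hab : a ≤ b) :
    IntervalIntegrable (fun t => rhsDensity β x₀ s h t N (fun j => u j t) (fun j => v j t)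
      (fun j => w j t)) volume a b := by
  have h1 := P.intervalIntegrable_fullOp (β := β) (x₀ := x₀) (s := s) (h := h) hab
  have h2 := P.intervalIntegrable_obsSq (β := β) (x₀ := x₀) (h := h)
  have h3 := RegularPath.continuous_innerEdgeSq (h := h) (N := N) v P.continuous
  have h4 : Continuous fun t => diffPlus h (fun j => u j t) N ^ 2 := by
    have := P.continuous_u
    unfold diffPlus
    fun_prop
  exact ((h1.add ((h4.intervalIntegrable _ _).const_mul _)).add (h2.const_mul _)).add
    ((h3.intervalIntegrable _ _).const_mul _)

/-- The integrated Carleman estimate. The boundary terms at `t = ± T` have a favorable sign. -/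
theorem integrated (A : Admissible β x₀ s h T R δ γ c n N) (P : RegularPath (-T) T N u v w) :
    (∫ t in (-T)..T, ∑ k ∈ Finset.range N,
        mainPart β x₀ s h t (fun j => u j t) (fun j => w j t) k ^ 2) +
      c * (s * ∫ t in (-T)..T, lhsDensity s h N (fun j => u j t) (fun j => v j t)) ≤
      (2 + 12 * n + 20 * R + 2 * (32 * T ^ 2 + 16 * x₀ ^ 2)) *
        ∫ t in (-T)..T, rhsDensity β x₀ s h t N (fun j => u j t) (fun j => v j t)
          (fun j => w j t) := by
  have hT := A.T_pos
  have hTT : -T ≤ T := by linarith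
  set K := 2 + 12 * (n : ℝ) + 20 * R + 2 * (32 * T ^ 2 + 16 * x₀ ^ 2)
  have i1 := P.intervalIntegrable_mainPart (β := β) (x₀ := x₀) (s := s) (h := h) hTT
  have i2 := intervalIntegrable_lhsDensity (s := s) (h := h) P (-T) T
  have i3 := intervalIntegrable_rhsDensity (β := β) (x₀ := x₀) (s := s) (h := h) P hTT
  have i4 := ((i3.const_mul K).sub i1).sub ((i2.const_mul s).const_mul c)
  have key := sub_le_integral_of_deriv_le hTT
    (P.ac_boundaryForm (β := β) (x₀ := x₀) (s := s) (h := h)) (i4.div_const 2)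
    (P.ae_hasDerivAt.mono fun t ht => P.hasDerivAt_boundaryForm ht)
    (fun t ht => by
      have := A.pointwise (abs_le.2 ht) (u := fun j => u j t) (v := fun j => v j t)
        (P.u_first t) (P.u_last t) (P.v_first t) (P.v_last t)
        (w := fun j => w j t)
      rw [le_div_iff₀ two_pos]
      linarith)
  rw [intervalIntegral.integral_div,
    intervalIntegral.integral_sub ((i3.const_mul K).sub i1) ((i2.const_mul s).const_mul c),
    intervalIntegral.integral_sub (i3.const_mul K) i1, intervalIntegral.integral_const_mul,
    intervalIntegral.integral_const_mul, intervalIntegral.integral_const_mul] at key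
  have b1 := A.toFineMesh.boundaryForm_nonneg A.β_pos A.β_lt_one hT A.γ_pos A.gap A.small_R
    A.large_γ (u := fun j => u j T) (P.u_first T) (P.u_last T) (v := fun j => v j T)
  have b2 := A.toFineMesh.boundaryForm_neg_nonpos A.β_pos A.β_lt_one hT A.γ_pos A.gap A.small_R
    A.large_γ (u := fun j => u j (-T)) (P.u_first (-T)) (P.u_last (-T))
    (v := fun j => v j (-T))
  linarith

/-- The bound on the initial velocity of a function vanishing at `t = 0`, obtained by testing the
main part with the cut-off velocity on `(-T, 0)`. -/
theorem initial_velocity (A : Admissible β x₀ s h T R δ γ c n N)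
    (P : RegularPath (-T) T N u v w) (h0 : ∀ j ∈ Finset.Icc 1 N, u j 0 = 0) :
    s ^ (1 / 2 : ℝ) * nodeSq N (fun j => v j 0) ≤
      (∫ t in (-T)..T, ∑ k ∈ Finset.range N,
        mainPart β x₀ s h t (fun j => u j t) (fun j => w j t) k ^ 2) +
      (1 + 2 / T + 4 * T) *
        (s * ∫ t in (-T)..T, lhsDensity s h N (fun j => u j t) (fun j => v j t)) := by
  have hT := A.T_pos
  have hs := A.s_pos
  have hTT : -T ≤ T := by linarith
  have hT0 : -T ≤ 0 := by linarith
  set q := s ^ (1 / 2 : ℝ) with hq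
  have hq0 : 0 ≤ q := Real.rpow_nonneg hs.le _
  have hq2 : q ^ 2 = s := by
    rw [hq, ← Real.sqrt_eq_rpow, Real.sq_sqrt hs.le]
  have hqs : q ≤ s := by
    have := Real.rpow_le_rpow_of_exponent_le A.one_le_s (by norm_num : (1 / 2 : ℝ) ≤ 1)
    rwa [Real.rpow_one] at this
  have i1 := P.intervalIntegrable_mainPart (β := β) (x₀ := x₀) (s := s) (h := h) hTT
  have i2 := intervalIntegrable_lhsDensity (s := s) (h := h) P (-T) T
  set C := 1 / 2 + 1 / T + 2 * T with hC
  have i3 := (i1.div_const 2).add ((i2.const_mul s).const_mul C)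
  have hsub : Set.uIcc (-T) 0 ⊆ Set.uIcc (-T) T := by
    rw [Set.uIcc_of_le hT0, Set.uIcc_of_le hTT]
    exact Set.Icc_subset_Icc_right hT.le
  have hη : AbsolutelyContinuousOnInterval (fun t => q * (1 + t / T)) (-T) 0 :=
    ContDiffOn.absolutelyContinuousOnInterval (ContDiff.contDiffOn (by fun_prop))
  have hF := hη.fun_mul
    ((P.ac_energy (β := β) (x₀ := x₀) (s := s) (h := h)).mono hsub)
  have key := sub_le_integral_of_deriv_le hT0 hF (i3.mono_set hsub)
    (P.ae_hasDerivAt.mono fun t ht => by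
      have hd : HasDerivAt (fun t => q * (1 + t / T)) (q * (1 / T)) t :=
        (((hasDerivAt_id t).div_const T).const_add 1).const_mul q
      exact hd.mul (P.hasDerivAt_energy (β := β) (x₀ := x₀) (s := s) (h := h) ht))
    (fun t ht => by
      have := A.toFineMesh.energy_growth_le A.β_pos A.β_lt_one hT ht hq0 hq2 hqs
        (u := fun j => u j t) (v := fun j => v j t) (P.u_first t) (P.u_last t)
        (P.v_first t) (P.v_last t) (w := fun j => w j t)
      refine le_trans (le_of_eq ?_) this
      ring)
  have hmono : (∫ t in (-T)..0, ((∑ k ∈ Finset.range N,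
        mainPart β x₀ s h t (fun j => u j t) (fun j => w j t) k ^ 2) / 2 +
        C * (s * lhsDensity s h N (fun j => u j t) (fun j => v j t)))) ≤
      ∫ t in (-T)..T, ((∑ k ∈ Finset.range N,
        mainPart β x₀ s h t (fun j => u j t) (fun j => w j t) k ^ 2) / 2 +
        C * (s * lhsDensity s h N (fun j => u j t) (fun j => v j t))) := by
    refine intervalIntegral.integral_mono_interval le_rfl hT0 hT.le ?_ i3
    refine Filter.Eventually.of_forall fun t => ?_
    have g1 : 0 ≤ ∑ k ∈ Finset.range N,
        mainPart β x₀ s h t (fun j => u j t) (fun j => w j t) k ^ 2 :=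
      Finset.sum_nonneg fun _ _ => sq_nonneg _
    have g2 : 0 ≤ lhsDensity s h N (fun j => u j t) (fun j => v j t) :=
      add_nonneg (add_nonneg nodeSq_nonneg edgeSq_nonneg)
        (mul_nonneg (sq_nonneg s) nodeSq_nonneg)
    simp only [Pi.zero_apply]
    positivity
  have hE0 : energy β x₀ s h 0 N (fun j => u j 0) (fun j => v j 0) =
      nodeSq N (fun j => v j 0) / 2 := by
    rw [energy, nodeSq, Finset.sum_div]
    refine Finset.sum_congr rfl fun k hk => ?_
    have : u (k + 1) 0 = 0 := h0 _ (by
      have := Finset.mem_range.1 hk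
      rw [Finset.mem_Icc]; omega)
    rw [this]
    ring
  have hηT : 1 + -T / T = 0 := by field_simp; ring
  rw [hE0, hηT] at key
  rw [intervalIntegral.integral_add (i1.div_const 2) ((i2.const_mul s).const_mul C),
    intervalIntegral.integral_div, intervalIntegral.integral_const_mul,
    intervalIntegral.integral_const_mul] at hmono
  have e : 1 + 2 / T + 4 * T = 2 * C := by rw [hC]; ring
  rw [e]
  have key2 := key.trans hmono
  simp only [zero_div, add_zero, mul_one, mul_zero, zero_mul, sub_zero] at key2
  linarith

end Admissible

/-! ### The conjugated operator along a regular path -/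

theorem exp_mul_exp_weight_succ (β x₀ s h t : ℝ) (k : ℕ) :
    Real.exp (s * weight β x₀ t (k * h)) * Real.exp (-s * weight β x₀ t ((k + 1 : ℕ) * h)) =
      edgeCosh x₀ s h k - edgeSinh x₀ s h k := by
  rw [edgeCosh, edgeSinh, Real.cosh_sub_sinh, ← Real.exp_add]
  congr 1
  unfold weight edgeArg
  simp only [sq_abs]
  push_cast
  ring

theorem exp_weight_succ_mul_exp (β x₀ s h t : ℝ) (k : ℕ) :
    Real.exp (s * weight β x₀ t ((k + 1 : ℕ) * h)) * Real.exp (-s * weight β x₀ t (k * h)) =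
      edgeCosh x₀ s h k + edgeSinh x₀ s h k := by
  rw [edgeCosh, edgeSinh, Real.cosh_add_sinh, ← Real.exp_add]
  congr 1
  unfold weight edgeArg
  simp only [sq_abs]
  push_cast
  ring

theorem hasDerivAt_exp_neg_weight (β x₀ s t x : ℝ) :
    HasDerivAt (fun τ => Real.exp (-s * weight β x₀ τ x))
      (Real.exp (-s * weight β x₀ t x) * (2 * β * s * t)) t := by
  refine HasDerivAt.exp ?_
  have h1 : HasDerivAt (fun τ : ℝ => τ ^ 2) (2 * t) t := by
    simpa using hasDerivAt_pow 2 t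
  have h2 := ((h1.const_mul β).const_sub (|x - x₀| ^ 2)).const_mul (-s)
  refine h2.congr_deriv ?_
  ring

theorem conjWaveOp_eq_fullOp {β x₀ s h t : ℝ} {y u v w : ℕ → ℝ → ℝ} {k : ℕ}
    (hy0 : y k t = u k t) (hy1 : ∀ᶠ τ in nhds t, y (k + 1) τ = u (k + 1) τ)
    (hy2 : y (k + 2) t = u (k + 2) t)
    (hu : ∀ τ, HasDerivAt (u (k + 1)) (v (k + 1) τ) τ)
    (hv : HasDerivAt (v (k + 1)) (w (k + 1) t) t) :
    conjWaveOp β x₀ s h (fun _ => 0) y (k + 1) t =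
      fullOp β x₀ s h t (fun j => u j t) (fun j => v j t) (fun j => w j t) k := by
  set x : ℝ := (k + 1 : ℕ) * h with hx
  set g : ℝ → ℝ := fun τ => Real.exp (-s * weight β x₀ τ x) with hg
  have hgd : ∀ τ, HasDerivAt g (g τ * (2 * β * s * τ)) τ := fun τ =>
    hasDerivAt_exp_neg_weight β x₀ s τ x
  have h1 : (fun τ => g τ * y (k + 1) τ) =ᶠ[nhds t] fun τ => g τ * u (k + 1) τ := by
    filter_upwards [hy1] with τ hτ
    rw [hτ]
  have h2 : deriv (fun τ => g τ * u (k + 1) τ) =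
      fun τ => g τ * (2 * β * s * τ) * u (k + 1) τ + g τ * v (k + 1) τ :=
    funext fun τ => ((hgd τ).mul (hu τ)).deriv
  have hl : HasDerivAt (fun τ : ℝ => 2 * β * s * τ) (2 * β * s) t := by
    simpa using (hasDerivAt_id t).const_mul (2 * β * s)
  have h3 : deriv (deriv (fun τ => g τ * y (k + 1) τ)) t =
      g t * (w (k + 1) t + 2 * (2 * β * s * t) * v (k + 1) t + 2 * β * s * u (k + 1) t +
        (2 * β * s * t) ^ 2 * u (k + 1) t) := by
    rw [h1.deriv.deriv_eq, h2]
    have := (((hgd t).mul hl).mul (hu t)).add ((hgd t).mul hv)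
    refine (HasDerivAt.deriv this).trans ?_
    simp only [Pi.mul_apply]
    ring
  have hone : Real.exp (s * weight β x₀ t x) * g t = 1 := by
    rw [hg, ← Real.exp_add]
    simp
  have e1 := exp_mul_exp_weight_succ β x₀ s h t (k + 1)
  have e2 := exp_weight_succ_mul_exp β x₀ s h t k
  rw [← hx] at e1 e2
  unfold conjWaveOp waveOp discreteLaplacian
  simp only [Nat.add_sub_cancel, add_assoc, one_add_one_eq_two] at e1 ⊢
  rw [← hx]
  have h3' : deriv (deriv fun τ => Real.exp (-s * weight β x₀ τ x) * y (k + 1) τ) t = _ := h3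
  rw [h3', hy0, hy1.self_of_nhds, hy2]
  have hgt : Real.exp (-s * weight β x₀ t x) = g t := rfl
  rw [hgt]
  set G := Real.exp (s * weight β x₀ t x)
  set G2 := Real.exp (-s * weight β x₀ t ((k + 2 : ℕ) * h))
  set G0 := Real.exp (-s * weight β x₀ t (k * h))
  unfold fullOp mainPart symOp skewOp
  linear_combination (w (k + 1) t + 2 * (2 * β * s * t) * v (k + 1) t + 2 * β * s * u (k + 1) t +
        (2 * β * s * t) ^ 2 * u (k + 1) t + 2 * u (k + 1) t / h ^ 2) * hone -
      u (k + 2) t / h ^ 2 * e1 - u k t / h ^ 2 * e2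

theorem meshIntegral_eq (L : ℝ) (N : ℕ) (f : ℕ → ℝ) :
    meshIntegral L N f = meshSize L N * ∑ k ∈ Finset.range N, f (k + 1) := by
  rw [meshIntegral, Finset.range_eq_Ico, Finset.sum_Ico_add']
  rfl

/-- The mesh functions admitted in the theorem agree on `(-T, T)` with regular paths, whose entries
outside the interior nodes are set to zero. -/
theorem exists_regularPath {T : ℝ} (hT : 0 < T) {N : ℕ} {y : ℕ → ℝ → ℝ}
    (hy : ∀ j ∈ Finset.Icc 1 N, MemH2 (-T) T (y j))
    (hbc : ∀ t ∈ Set.Ioo (-T) T, y 0 t = 0 ∧ y (N + 1) t = 0) :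
    ∃ u v w : ℕ → ℝ → ℝ, RegularPath (-T) T N u v w ∧
      ∀ j ≤ N + 1, ∀ t ∈ Set.Ioo (-T) T, y j t = u j t := by
  classical
  have hex : ∀ j, ∃ u v w : ℝ → ℝ, (∀ t, HasDerivAt u (v t) t) ∧ Continuous v ∧
      AbsolutelyContinuousOnInterval v (-T) T ∧
      MemLp w 2 (volume.restrict (Set.Ioo (-T) T)) ∧ (∀ᵐ t, HasDerivAt v (w t) t) ∧
      (j ∈ Finset.Icc 1 N → ∀ t ∈ Set.Ioo (-T) T, y j t = u t) ∧
      (j ∉ Finset.Icc 1 N → (∀ t, u t = 0) ∧ ∀ t, v t = 0) := by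
    intro j
    by_cases hj : j ∈ Finset.Icc 1 N
    · obtain ⟨u, v, w, h1, h2, h3, h4, h5, h6⟩ := (hy j hj).exists_regular (by linarith)
      exact ⟨u, v, w, h1, h2, h3, h4, h5, fun _ => h6, fun h => (h hj).elim⟩
    · exact ⟨fun _ => 0, fun _ => 0, fun _ => 0, fun t => hasDerivAt_const t 0,
        continuous_const, absolutelyContinuousOnInterval_const _ _ _, MemLp.zero,
        Filter.Eventually.of_forall fun t => hasDerivAt_const t 0, fun h => (hj h).elim,
        fun _ => ⟨fun _ => rfl, fun _ => rfl⟩⟩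
  choose u v w h1 h2 h3 h4 h5 h6 h7 using hex
  have n0 : 0 ∉ Finset.Icc 1 N := by simp
  have nN : N + 1 ∉ Finset.Icc 1 N := by simp
  refine ⟨u, v, w, ⟨h1, h2, h3, h4, ae_all_iff.2 h5, (h7 0 n0).1, (h7 _ nN).1, (h7 0 n0).2,
    (h7 _ nN).2⟩, ?_⟩
  intro j hj t ht
  by_cases hmem : j ∈ Finset.Icc 1 N
  · exact h6 j hmem t ht
  · rw [(h7 j hmem).1 t]
    rw [Finset.mem_Icc] at hmem
    rcases (by omega : j = 0 ∨ j = N + 1) with rfl | rfl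
    · exact (hbc t ht).1
    · exact (hbc t ht).2

theorem intervalIntegral_congr_Ioo {a b : ℝ} (hab : a ≤ b) {f g : ℝ → ℝ}
    (h : ∀ᵐ t, t ∈ Set.Ioo a b → f t = g t) : ∫ t in a..b, f t = ∫ t in a..b, g t := by
  rw [intervalIntegral.integral_of_le hab, intervalIntegral.integral_of_le hab,
    integral_Ioc_eq_integral_Ioo, integral_Ioc_eq_integral_Ioo]
  refine integral_congr_ae ?_
  rwa [Filter.EventuallyEq, ae_restrict_iff' measurableSet_Ioo]

section Bridge

variable {β x₀ L T M s : ℝ} {N : ℕ} {y u v w : ℕ → ℝ → ℝ}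

theorem deriv_eq_of_eqOn (P : RegularPath (-T) T N u v w)
    (hyu : ∀ j ≤ N + 1, ∀ t ∈ Set.Ioo (-T) T, y j t = u j t) {j : ℕ} (hj : j ≤ N + 1) {t : ℝ}
    (ht : t ∈ Set.Ioo (-T) T) : deriv (y j) t = v j t := by
  have : y j =ᶠ[nhds t] u j := by
    filter_upwards [isOpen_Ioo.mem_nhds ht] with τ hτ
    exact hyu j hj τ hτ
  rw [this.deriv_eq, (P.hasDerivAt j t).deriv]

theorem carlemanLHS_le (hL : 0 < L) (hT : 0 < T) (hs : 0 < s) (P : RegularPath (-T) T N u v w)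
    (hyu : ∀ j ≤ N + 1, ∀ t ∈ Set.Ioo (-T) T, y j t = u j t) :
    carlemanLHS L T s N y ≤ meshSize L N *
      (s * ∫ t in (-T)..T, lhsDensity s (meshSize L N) N (fun j => u j t) (fun j => v j t)) := by
  have hTT : -T ≤ T := by linarith
  set h := meshSize L N with hh
  have hh0 : 0 < h := by rw [hh, meshSize]; positivity
  have hc1 := RegularPath.continuous_nodeSq (N := N) u P.continuous_u
  have hc2 := RegularPath.continuous_nodeSq (N := N) v P.continuous
  have hc3 := RegularPath.continuous_edgeSq (h := h) (N := N) u P.continuous_u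
  have hc4 := RegularPath.continuous_innerEdgeSq (h := h) (N := N) u P.continuous_u
  have e : (∫ t in (-T)..T, meshIntegral L N fun j =>
      |deriv (y j) t| ^ 2 + |diffPlus h (fun i => y i t) j| ^ 2 + s ^ 2 * |y j t| ^ 2) =
      ∫ t in (-T)..T, h * (nodeSq N (fun j => v j t) + innerEdgeSq h N (fun j => u j t) +
        s ^ 2 * nodeSq N (fun j => u j t)) := by
    refine intervalIntegral_congr_Ioo hTT (Filter.Eventually.of_forall fun t ht => ?_)
    rw [meshIntegral_eq, nodeSq, nodeSq, innerEdgeSq, Finset.mul_sum (a := s ^ 2),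
      ← Finset.sum_add_distrib, ← Finset.sum_add_distrib]
    congr 1
    refine Finset.sum_congr rfl fun k hk => ?_
    have hk' := Finset.mem_range.1 hk
    rw [deriv_eq_of_eqOn P hyu (by omega) ht, sq_abs, sq_abs, sq_abs]
    unfold diffPlus
    beta_reduce
    rw [hyu (k + 1) (by omega) t ht, hyu (k + 1 + 1) (by omega) t ht]
  rw [carlemanLHS, e, intervalIntegral.integral_const_mul, mul_left_comm]
  refine mul_le_mul_of_nonneg_left (mul_le_mul_of_nonneg_left ?_ hs.le) hh0.le
  refine intervalIntegral.integral_mono_on hTT (Continuous.intervalIntegrable (by fun_prop) _ _)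
    (Admissible.intervalIntegrable_lhsDensity P _ _) fun t _ => ?_
  unfold lhsDensity
  have := innerEdgeSq_le_edgeSq (h := h) (N := N) (u := fun j => u j t)
  linarith

theorem carlemanRHS_eq (hL : 0 < L) (hT : 0 < T) (P : RegularPath (-T) T N u v w)
    (hyu : ∀ j ≤ N + 1, ∀ t ∈ Set.Ioo (-T) T, y j t = u j t) (hx₀ : x₀ < 0) :
    carlemanRHS β x₀ L T M s N y = M * (meshSize L N *
      ∫ t in (-T)..T, rhsDensity β x₀ s (meshSize L N) t N (fun j => u j t) (fun j => v j t)
        (fun j => w j t)) := by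
  have hTT : -T ≤ T := by linarith
  set h := meshSize L N with hh
  have hh0 : 0 < h := by rw [hh, meshSize]; positivity
  have hNh : (N + 1) * h = L := by rw [hh, meshSize]; field_simp
  have i1 := P.intervalIntegrable_fullOp (β := β) (x₀ := x₀) (s := s) (h := h) hTT
  have i2 := P.intervalIntegrable_obsSq (β := β) (x₀ := x₀) (h := h)
  have i3 : IntervalIntegrable (fun t => innerEdgeSq h N (fun j => v j t)) volume (-T) T :=
    (RegularPath.continuous_innerEdgeSq v P.continuous).intervalIntegrable _ _
  have i4 : IntervalIntegrable (fun t => diffPlus h (fun j => u j t) N ^ 2) volume (-T) T := by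
    have := P.continuous_u
    refine Continuous.intervalIntegrable ?_ _ _
    unfold diffPlus
    fun_prop
  have e1 : (∫ t in (-T)..T, meshIntegral L N fun j =>
      |conjWaveOp β x₀ s h (fun _ => 0) y j t| ^ 2) =
      ∫ t in (-T)..T, h * ∑ k ∈ Finset.range N,
        fullOp β x₀ s h t (fun j => u j t) (fun j => v j t) (fun j => w j t) k ^ 2 := by
    refine intervalIntegral_congr_Ioo hTT ?_
    filter_upwards [P.ae_hasDerivAt] with t htd ht
    rw [meshIntegral_eq]
    congr 1
    refine Finset.sum_congr rfl fun k hk => ?_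
    have hk' := Finset.mem_range.1 hk
    rw [sq_abs, conjWaveOp_eq_fullOp (hyu k (by omega) t ht) ?_ (hyu (k + 2) (by omega) t ht)
      (P.hasDerivAt (k + 1)) (htd (k + 1))]
    filter_upwards [isOpen_Ioo.mem_nhds ht] with τ hτ
    exact hyu _ (by omega) τ hτ
  have e2 : (∫ t in (-T)..T, |diffMinus h (fun i => y i t) (N + 1)| ^ 2) =
      ∫ t in (-T)..T, diffPlus h (fun j => u j t) N ^ 2 := by
    refine intervalIntegral_congr_Ioo hTT (Filter.Eventually.of_forall fun t ht => ?_)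
    rw [sq_abs, diffMinus, diffPlus, Nat.add_sub_cancel, hyu N (by omega) t ht,
      hyu (N + 1) le_rfl t ht]
  have e3 : (∫ t in (-T)..T, meshIntegral L N fun j =>
      open Classical in
      if (|t|, (j : ℝ) * h) ∈ obsSet β x₀ L T then |y j t| ^ 2 else 0) =
      ∫ t in (-T)..T, h * obsSq β x₀ h t N (fun j => u j t) := by
    refine intervalIntegral_congr_Ioo hTT ?_
    -- `𝒪` only contains positive times, so that `t = 0` has to be left out
    have hne : ∀ᵐ t : ℝ, t ≠ 0 := by simp [ae_iff, measure_singleton]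
    filter_upwards [hne] with t ht0 ht
    rw [meshIntegral_eq, obsSq]
    congr 1
    refine Finset.sum_congr rfl fun k hk => ?_
    have hk' := Finset.mem_range.1 hk
    have hx1 : 0 < ((k : ℝ) + 1) * h := by positivity
    have hx2 : ((k : ℝ) + 1) * h < L := by
      rw [← hNh]
      have : (k : ℝ) < N := by exact_mod_cast hk'
      exact mul_lt_mul_of_pos_right (by linarith) hh0
    have hiff : (|t|, ((k + 1 : ℕ) : ℝ) * h) ∈ obsSet β x₀ L T ↔
        ((k : ℝ) + 1) * h - x₀ < β * |t| := by
      unfold obsSet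
      simp only [Set.mem_ofPred_eq, Set.mem_Ioo]
      push_cast
      rw [abs_of_pos (by linarith : 0 < ((k : ℝ) + 1) * h - x₀)]
      exact ⟨fun h' => h'.2.2, fun h' => ⟨⟨abs_pos.2 ht0, abs_lt.2 ht⟩, ⟨hx1, hx2⟩, h'⟩⟩
    simp only [hiff]
    rw [hyu (k + 1) (by omega) t ht, sq_abs]
  have e4 : (∫ t in (-T)..T, meshIntegral L N fun j =>
      |deriv (fun τ => diffPlus h (fun i => y i τ) j) t| ^ 2) =
      ∫ t in (-T)..T, h * innerEdgeSq h N (fun j => v j t) := by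
    refine intervalIntegral_congr_Ioo hTT (Filter.Eventually.of_forall fun t ht => ?_)
    rw [meshIntegral_eq, innerEdgeSq]
    congr 1
    refine Finset.sum_congr rfl fun k hk => ?_
    have hk' := Finset.mem_range.1 hk
    have : (fun τ => diffPlus h (fun i => y i τ) (k + 1)) =ᶠ[nhds t]
        fun τ => (u (k + 1 + 1) τ - u (k + 1) τ) / h := by
      filter_upwards [isOpen_Ioo.mem_nhds ht] with τ hτ
      rw [diffPlus, hyu (k + 1) (by omega) τ hτ, hyu (k + 1 + 1) (by omega) τ hτ]
    have hd : HasDerivAt (fun τ => (u (k + 1 + 1) τ - u (k + 1) τ) / h)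
        ((v (k + 1 + 1) t - v (k + 1) t) / h) t :=
      ((P.hasDerivAt (k + 1 + 1) t).sub (P.hasDerivAt (k + 1) t)).div_const h
    rw [sq_abs, this.deriv_eq, hd.deriv, diffPlus]
  rw [carlemanRHS, ← hh, e1, e2, e3, e4]
  unfold rhsDensity
  rw [intervalIntegral.integral_add ((i1.add (i4.const_mul _)).add (i2.const_mul _))
      (i3.const_mul _), intervalIntegral.integral_add (i1.add (i4.const_mul _)) (i2.const_mul _),
    intervalIntegral.integral_add i1 (i4.const_mul _)]
  simp only [intervalIntegral.integral_const_mul]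
  field_simp

end Bridge

/-! ### Choice of the parameters -/

theorem sub_le_supDist {L x₀ : ℝ} (hL : 0 < L) (hx₀ : x₀ < 0) : L - x₀ ≤ supDist L x₀ := by
  have hbdd : BddAbove ((fun x : ℝ => |x - x₀|) '' Set.Ioo 0 L) := by
    refine ⟨L - x₀, ?_⟩
    rintro _ ⟨x, hx, rfl⟩
    simp only
    rw [abs_of_pos (by linarith [hx.1])]
    linarith [hx.2]
  have h : ∀ x ∈ Set.Ioo 0 L, x - x₀ ≤ supDist L x₀ := fun x hx =>
    (le_abs_self _).trans (le_csSup hbdd ⟨x, hx, rfl⟩)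
  by_contra hlt
  rw [not_le] at hlt
  have h2 := h (max (L / 2) ((L + (supDist L x₀ + x₀)) / 2))
    ⟨lt_max_of_lt_left (by linarith), max_lt (by linarith) (by linarith)⟩
  have := le_max_right (L / 2) ((L + (supDist L x₀ + x₀)) / 2)
  linarith

theorem exists_small_parameter {R δ C D : ℝ} (hδ : 0 < δ) (hD : 0 < D) :
    ∃ ε > 0, Real.cosh (2 * ε * R) ≤ 1 + δ ∧ ε ^ 2 * C ≤ D ∧ ε * R ≤ 1 := by
  have h1 : ∀ᶠ ε in nhdsWithin (0 : ℝ) (Set.Ioi 0), Real.cosh (2 * ε * R) < 1 + δ := by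
    have hc : Continuous fun ε : ℝ => Real.cosh (2 * ε * R) :=
      Real.continuous_cosh.comp (by fun_prop)
    exact (hc.tendsto' 0 1 (by simp)).mono_left nhdsWithin_le_nhds |>.eventually_lt_const
      (by linarith)
  have h2 : ∀ᶠ ε in nhdsWithin (0 : ℝ) (Set.Ioi 0), ε ^ 2 * C < D := by
    have hc : Continuous fun ε : ℝ => ε ^ 2 * C := by fun_prop
    exact (hc.tendsto' 0 0 (by simp)).mono_left nhdsWithin_le_nhds |>.eventually_lt_const hD
  have h3 : ∀ᶠ ε in nhdsWithin (0 : ℝ) (Set.Ioi 0), ε * R < 1 := by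
    have hc : Continuous fun ε : ℝ => ε * R := by fun_prop
    exact (hc.tendsto' 0 0 (by simp)).mono_left nhdsWithin_le_nhds |>.eventually_lt_const one_pos
  obtain ⟨ε, ⟨⟨a1, a2⟩, a3⟩, a4⟩ := (((h1.and h2).and h3).and self_mem_nhdsWithin).exists
  exact ⟨ε, a4, a1.le, a2.le, a3.le⟩

theorem exists_admissible {L T β x₀ : ℝ} (hL : 0 < L) (hx₀ : x₀ < 0)
    (hβ : β ∈ Set.Ioo (0 : ℝ) 1) (hβT : supDist L x₀ < β * T) :
    ∃ δ γ c : ℝ, ∃ n : ℕ, ∃ s₀ > (0 : ℝ), ∃ ε₀ > (0 : ℝ), 0 < c ∧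
      ∀ N : ℕ, n ≤ N → ∀ s ∈ Set.Icc s₀ (ε₀ / meshSize L N),
        Admissible β x₀ s (meshSize L N) T (L - x₀) δ γ c n N := by
  obtain ⟨hβ0, hβ1⟩ := hβ
  have hRT : L - x₀ < β * T := (sub_le_supDist hL hx₀).trans_lt hβT
  set R := L - x₀ with hR
  have hR0 : 0 < R := by linarith
  have hG0 : 0 < β * T := hR0.trans hRT
  have hT : 0 < T := pos_of_mul_pos_right hG0 hβ0.le
  have h1β : 0 < 1 - β := by linarith
  have hx2 : 0 < x₀ ^ 2 := by nlinarith
  set γ := (β * T - R) / 3 with hγ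
  have hγ0 : 0 < γ := by rw [hγ]; linarith
  set δ := min ((1 - β) / 16) (γ / R) with hδ
  have hδ0 : 0 < δ := lt_min (by positivity) (by positivity)
  have hδ1 : δ ≤ (1 - β) / 16 := min_le_left _ _
  have hδR : R * δ ≤ γ := by
    have : δ ≤ γ / R := min_le_right _ _
    rw [le_div_iff₀ hR0] at this
    linarith
  set c := min ((1 - β) / 2) (8 * (1 - β) * x₀ ^ 2) with hc
  have hc0 : 0 < c := lt_min (by positivity) (by positivity)
  obtain ⟨ε, hε0, hε1, hε2, hε3⟩ := exists_small_parameter (R := R)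
    (C := 64 * R ^ 4 / δ + 32 * R ^ 2 * T ^ 2) hδ0
    (by positivity : 0 < 8 * (1 - β) * x₀ ^ 2)
  -- `s₀` is so large that `h ≤ ε / s₀` makes the mesh fine compared with `|x₀|` and `γ`
  set s₀ := 1 + 208 / c + 3 / (β * T * γ) + ε / γ + ε / (-x₀) with hs₀
  have p1 : 0 < 208 / c := by positivity
  have p2 : 0 < 3 / (β * T * γ) := by positivity
  have p3 : 0 < ε / γ := by positivity
  have p4 : 0 < ε / (-x₀) := div_pos hε0 (by linarith)
  refine ⟨δ, γ, c, ⌈8 / (1 - β)⌉₊, s₀, by positivity, ε, hε0, hc0, ?_⟩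
  intro N hN s hs
  set h := meshSize L N with hh
  have hh0 : 0 < h := by rw [hh, meshSize]; positivity
  have hNh : (N + 1) * h = L := by rw [hh, meshSize]; field_simp
  have hs0 : 0 < s := lt_of_lt_of_le (by positivity) hs.1
  have hsh : s * h ≤ ε := (le_div_iff₀ hh0).1 hs.2
  have hsh0 : 0 < s * h := mul_pos hs0 hh0
  have key : ∀ {a : ℝ}, 0 < a → ε / a ≤ s → h ≤ a := by
    intro a ha has
    rw [div_le_iff₀ ha] at has
    by_contra hlt
    rw [not_le] at hlt
    nlinarith
  have hhγ : h ≤ γ := key hγ0 (by linarith [hs.1])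
  exact
    { h_pos := hh0
      s_pos := hs0
      x₀_neg := hx₀
      length_eq := by rw [hNh]
      δ_pos := hδ0
      δ_le := by linarith
      cosh_le := by
        refine le_trans ?_ hε1
        have e : 2 * s * h * R ≤ 2 * ε * R := by nlinarith
        rw [Real.cosh_le_cosh, abs_of_pos (by positivity), abs_of_pos (by positivity)]
        exact e
      β_pos := hβ0
      β_lt_one := hβ1
      T_pos := hT
      γ_pos := hγ0
      le_n := Nat.le_ceil _
      n_le := hN
      δ_le_sub := hδ1
      h_le := key (by linarith) (by linarith [hs.1])
      gap := by linarith
      small := by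
        refine le_trans ?_ hε2
        rw [← mul_pow]
        gcongr
      small_R := (mul_le_mul_of_nonneg_right hsh hR0.le).trans hε3
      large_γ := by
        have : 3 / (β * T * γ) ≤ s := by linarith [hs.1]
        rw [div_le_iff₀ (by positivity)] at this
        linarith
      one_le_s := by linarith [hs.1]
      c_le_sub := min_le_left _ _
      c_le_x₀ := min_le_right _ _
      large_c := by
        have : 208 / c ≤ s := by linarith [hs.1]
        rw [div_le_iff₀ hc0] at this
        linarith }

end SemiDiscreteWave

theorem theorem4p1 (L T β x₀ : ℝ) (hL : 0 < L) (hx₀ : x₀ < 0)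
    (hβ : β ∈ Set.Ioo (0 : ℝ) 1)
    (hT : supDist L x₀ < T) (hβT : supDist L x₀ < β * T) :
    ∃ s₀ > (0 : ℝ), ∃ N₀ > (0 : ℕ), ∃ ε₀ > (0 : ℝ), ∃ M > (0 : ℝ),
      ∀ N : ℕ, N₀ ≤ N → ∀ s ∈ Set.Icc s₀ (ε₀ / meshSize L N),
        ∀ y : ℕ → ℝ → ℝ,
          (∀ j ∈ Finset.Icc 1 N, MemH2 (-T) T (y j)) →
          (∀ t ∈ Set.Ioo (-T) T, y 0 t = 0 ∧ y (N + 1) t = 0) →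
          carlemanLHS L T s N y ≤ carlemanRHS β x₀ L T M s N y ∧
          ((∀ j ∈ Finset.Icc 1 N, y j 0 = 0) →
            carlemanLHS L T s N y +
                s ^ (1 / 2 : ℝ) * meshIntegral L N (fun j => |deriv (y j) 0| ^ 2) ≤
              carlemanRHS β x₀ L T M s N y) := by
  obtain ⟨δ, γ, c, n, s₀, hs₀, ε₀, hε₀, hc, hadm⟩ := exists_admissible hL hx₀ hβ hβT
  have hT0 : 0 < T := by
    have := sub_le_supDist hL hx₀
    linarith
  set C := 1 + 2 / T + 4 * T with hC
  have hC0 : 0 < C := by positivity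
  have hR : 0 < L - x₀ := by linarith
  set K := 2 + 12 * (n : ℝ) + 20 * (L - x₀) + 2 * (32 * T ^ 2 + 16 * x₀ ^ 2) with hK
  have hK0 : 0 < K := by positivity
  refine ⟨s₀, hs₀, n + 1, n.succ_pos, ε₀, hε₀, (1 + (1 + C) / c) * K, by positivity, ?_⟩
  intro N hN s hs y hy hbc
  have A := hadm N (by omega) s hs
  have hs0 := A.s_pos
  obtain ⟨u, v, w, P, hyu⟩ := exists_regularPath hT0 hy hbc
  have hlhs := carlemanLHS_le hL hT0 hs0 P hyu
  have hint := A.integrated P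
  rw [carlemanRHS_eq hL hT0 P hyu hx₀]
  rw [← hK] at hint
  have hh := A.h_pos
  set h := meshSize L N with hhdef
  have hTT : -T ≤ T := by linarith
  have q1 : 0 ≤ ∫ t in (-T)..T, ∑ k ∈ Finset.range N,
      mainPart β x₀ s h t (fun j => u j t) (fun j => w j t) k ^ 2 :=
    intervalIntegral.integral_nonneg hTT fun _ _ => Finset.sum_nonneg fun _ _ => sq_nonneg _
  have q2 : 0 ≤ s * ∫ t in (-T)..T, lhsDensity s h N (fun j => u j t) (fun j => v j t) :=
    mul_nonneg hs0.le <| intervalIntegral.integral_nonneg hTT fun _ _ =>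
      add_nonneg (add_nonneg nodeSq_nonneg edgeSq_nonneg)
        (mul_nonneg (sq_nonneg s) nodeSq_nonneg)
  have hinit := A.initial_velocity P
  rw [← hC] at hinit
  set I₁ := ∫ t in (-T)..T, ∑ k ∈ Finset.range N,
    mainPart β x₀ s h t (fun j => u j t) (fun j => w j t) k ^ 2
  set I₂ := s * ∫ t in (-T)..T, lhsDensity s h N (fun j => u j t) (fun j => v j t)
  set I₃ := ∫ t in (-T)..T, rhsDensity β x₀ s h t N (fun j => u j t) (fun j => v j t)
    (fun j => w j t)
  have b1 : I₂ ≤ K * I₃ / c := by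
    rw [le_div_iff₀ hc]
    linarith
  have b2 : I₁ ≤ K * I₃ := by
    have := mul_nonneg hc.le q2
    linarith
  have b3 : (1 + (1 + C) / c) * K * (h * I₃) =
      h * (K * I₃ + (1 + C) * (K * I₃ / c)) := by field_simp
  have b4 := mul_le_mul_of_nonneg_left b1 (by positivity : 0 ≤ 1 + C)
  have b5 : 0 ≤ C * I₂ := mul_nonneg hC0.le q2
  rw [b3]
  constructor
  · exact hlhs.trans (mul_le_mul_of_nonneg_left (by linarith) hh.le)
  · intro h0
    have z : (0 : ℝ) ∈ Set.Ioo (-T) T := ⟨by linarith, hT0⟩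
    have hv := hinit fun j hj => by
      rw [← hyu j (by rw [Finset.mem_Icc] at hj; omega) 0 z]
      exact h0 j hj
    have e : meshIntegral L N (fun j => |deriv (y j) 0| ^ 2) =
        h * nodeSq N (fun j => v j 0) := by
      rw [meshIntegral_eq, nodeSq]
      congr 1
      refine Finset.sum_congr rfl fun k hk => ?_
      have := Finset.mem_range.1 hk
      rw [sq_abs, deriv_eq_of_eqOn P hyu (by omega) z]
    rw [e, mul_left_comm]
    refine (add_le_add hlhs (mul_le_mul_of_nonneg_left hv hh.le)).trans ?_
    rw [← mul_add]
    exact mul_le_mul_of_nonneg_left (by linarith) hh.le
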